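/- **Conventions.** For a real random variable $Z$ and $t\ge 0$ let $\mathcal L(Z,t)=\sup_{\lambda\in\mathbb R}\mathbb P\{|Z-\lambda|\le t\}$ be the Lévy concentration function. A Bernoulli($p$) variable takes the value $1$ with probability $p$ and $0$ with probability $1-p$. An integer interval is a set $\{u,u+1,\dots,v\}$ with $u,v\in\mathbb Z$. For integers $N,n\ge 1$ and real numbers $\delta\in(0,1]$, $K\ge 1$, a set $\mathcal A\subset\mathbb Z^n$ is called $(N,n,K,\delta)$-admissible if $\mathcal A=A_1\times\dots\times A_n$, where - every $A_i\subset\mathbb Z$ is symmetric about the origin; - for $i>\delta n$, $A_i$ is an integer interval of cardinality at least $2N+1$; - for $i\le\delta n$, $A_i$ is a union of two integer intervals, of total cardinality at least $2N$, and $A_i\cap[-N,N]=\emptyset$; - $|A_1|\cdot|A_2|\cdots|A_n|\le (KN)^n$; - $\max A_i<nN$ for all $i$. **Theorem.** (1) Let $\delta,\varepsilon\in(0,1]$, $p\in(0,1/2]$, $K\ge 1$. There is $L=L(\delta,\varepsilon,p,K)>0$ such that for every $M\ge 1$ there is $n_0=n_0(\delta,\varepsilon,p,K,M)\ge 1$ with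 the following property. Let $n\ge n_0$ and $N$ be integers with $1\le N\le(1-p+\varepsilon)^{-n}$, let $\mathcal A$ be an $(N,n,K,\delta)$-admissible set, and let $b_1,\dots,b_n$ be i.i.d. Bernoulli($p$) random variables. Then $$\Big|\Big\{x\in\mathcal A:\ \mathcal L\Big(\sum_{i=1}^n b_ix_i,\sqrt n\Big)\ge L\,N^{-1}\Big\}\Big|\le e^{-Mn}\,|\mathcal A|.$$ In particular $L$ does not depend on $M$. (2) Let $\delta\in(0,1]$, $p\in(0,1/2]$, $\varepsilon\in(0,p)$. There is $L=L(\delta,\varepsilon,p)>0$ such that for every $M\ge 1$ there is $n_0=n_0(\delta,\varepsilon,p,M)\ge 1$ with the following property. Let $n\ge n_0$ and $N$ be integers with $1\le N\le(1-p+\varepsilon)^{-n}$, and let the random vector $\xi=(\xi_1,\dots,\xi_n)$ be uniformly distributed on $$\{-2N,\dots,-N-1,N+1,\dots,2N\}^{\lfloor\delta n\rfloor}\times\{-N,-N+1,\dots,N\}^{n-\lfloor\delta n\rfloor}.$$ Then $$\mathbb P_\xi\Big\{\mathcal L_b\Big(\sum_{i=1}^n b_i\xi_i,\sqrt n\Big)>L\,N^{-1}\Big\}\le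 e^{-Mn},$$ where $\mathcal L_b$ denotes the Lévy concentration function with respect to the randomness of $b=(b_1,\dots,b_n)$, a vector of i.i.d. Bernoulli($p$) variables, with $\xi$ held fixed. -/

import Mathlib

open MeasureTheory ProbabilityTheory

/-- The Lévy concentration function `𝓛(Z, t) = sup_{c ∈ ℝ} P{|Z - c| ≤ t}` of a real random
variable `Z` on a probability space with measure `P`. -/
noncomputable def levyConcentration {Ω : Type*} [MeasurableSpace Ω] (P : Measure Ω)
    (Z : Ω → ℝ) (t : ℝ) : ℝ :=
  ⨆ c : ℝ, P.real {ω | |Z ω - c| ≤ t}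

/-- `b 0, …, b (n-1)` are mutually independent random variables on `(Ω, P)`, each of them taking
the value `1` with probability `p` and the value `0` with probability `1 - p`. -/
structure IsIIDBernoulli {Ω : Type*} [MeasurableSpace Ω] (P : Measure Ω) (p : ℝ) {n : ℕ}
    (b : Fin n → Ω → ℝ) : Prop where
  measurable : ∀ i, Measurable (b i)
  indep : iIndepFun b P
  prob_one : ∀ i, P {ω | b i ω = 1} = ENNReal.ofReal p
  prob_zero : ∀ i, P {ω | b i ω = 0} = ENNReal.ofReal (1 - p)

/-- A finite set of integers is an integer interval if it is `{u, u + 1, …, v}` for some `u, v`. -/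
def IsIntegerInterval (S : Finset ℤ) : Prop :=
  ∃ u v : ℤ, S = Finset.Icc u v

/-- The factors `A 0, …, A (n-1)` of an `(N, n, K, δ)`-admissible product set. The factor written
`A i` here, with `i : Fin n`, is the one with number `i + 1` when the factors are counted from
one. -/
structure AdmissibleFactors (N n : ℕ) (K δ : ℝ) (A : Fin n → Finset ℤ) : Prop where
  symmetric : ∀ i, ∀ a ∈ A i, -a ∈ A i
  interval : ∀ i : Fin n, δ * n < ((i : ℕ) + 1 : ℝ) →
    IsIntegerInterval (A i) ∧ 2 * N + 1 ≤ (A i).card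
  two_intervals : ∀ i : Fin n, ((i : ℕ) + 1 : ℝ) ≤ δ * n →
    (∃ I J : Finset ℤ, IsIntegerInterval I ∧ IsIntegerInterval J ∧ A i = I ∪ J) ∧
      2 * N ≤ (A i).card ∧ Disjoint (A i) (Finset.Icc (-(N : ℤ)) N)
  card_le : (∏ i, ((A i).card : ℝ)) ≤ (K * N) ^ n
  lt_mul : ∀ i, ∀ a ∈ A i, a < (n : ℤ) * N

/-- `(N, n, K, δ)`-admissible subsets of `ℤⁿ`. (Such sets are finite, as their factors are
symmetric about the origin and bounded above.) -/
def IsAdmissible (N n : ℕ) (K δ : ℝ) (𝒜 : Finset (Fin n → ℤ)) : Prop :=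
  ∃ A : Fin n → Finset ℤ, 𝒜 = Fintype.piFinset A ∧ AdmissibleFactors N n K δ A

/-- The box
`{-2N, …, -N-1, N+1, …, 2N}^⌊δn⌋ × {-N, …, N}^(n-⌊δn⌋)` in `ℤⁿ`. -/
noncomputable def standardBox (N n : ℕ) (δ : ℝ) : Finset (Fin n → ℤ) :=
  Fintype.piFinset fun i : Fin n =>
    if (i : ℕ) < ⌊δ * n⌋₊ then
      Finset.Icc (-2 * (N : ℤ)) (-(N : ℤ) - 1) ∪ Finset.Icc ((N : ℤ) + 1) (2 * N)
    else
      Finset.Icc (-(N : ℤ)) N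

/-!
Write `N⁻¹ n ^ (-1/2) = h` and let `f` be the density, modulo a large integer `q`, of `∑ bᵢ xᵢ` plus a
smooth variable of scale `√n`. It has to be shown that, for all but an `e ^ (-M n)` part of the
vectors `x`, `f ≤ L h` everywhere with `L` independent of `M`. Revealing the summands one at a time,
`f` evolves by `f(t) ↦ (1 - p) f(t) + p f(t + xᵢ)` (`walk`).

*Local means.* A small multiple of `n` of coordinates with `|xᵢ| ≥ N` gives, by the
Littlewood–Offord–Erdős bound, that the means of `f` over all windows of length `N` are `O(h)`, for
every `x` (`windowMean_walk_pointMass_le`). This persists under further steps, and it settles the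
case `N ≤ √n`.

*The path argument* (`card_exists_lt_walk_le`). Follow the larger of the two parents back from a
point where the walk exceeds a level `H`. A step at which the other parent is below `ε H` costs a
factor `1 - p + ε`. If, whatever the past, the other parent exceeds `ε H` with probability at most
`τ`, then by an exponential moment the event that `s` of these steps are bad for some path has
probability at most `4 ^ m q τ ^ s`. Local means give `τ = O(h / (ε H))` by Markov's inequality, and
since `N ≤ (1 - p + ε) ^ (-n)` there are enough steps to reach `H = R h`, where the constant `R` has
to depend on `M`.

*Removing the dependence on `M`.* The next `k = ⌊β n⌋` steps bring `f` close in `L²` to its means at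
scale `N` (`sum_sq_sub_windowMean_le`). In Fourier space the difference is small at frequencies
below `n ^ (-3/8) / N` because of the mean and above `n ^ (-1/8)` because of the smoothing. In
between, a multiplier which is not small would require about half of the `xᵢ` to multiply the
frequency to within `n ^ (-7/16)` of an integer, which has probability `n ^ (-c n)` and so beats
both `e ^ (-M n)` and the union over the `q` frequencies
(`IsSpread.card_resonantVectors_le`). Hence `f` exceeds a constant multiple of `h` on at most
`O(R n ^ (-1/4) N)` points, and the path argument for the last `k` steps, now with
`τ = O(R n ^ (-1/4))`, brings the maximum of `f` from `R h` down to `L h`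
(`IsSpread.card_exists_lt_le`).
-/

namespace BernoulliWalk

open Finset

/-! ### Averaging operators and the walk -/

section Walk

variable {G : Type*} [AddCommGroup G]

/-- `walk p y F l t = 𝔼 F (t + b₀ y₀ + ⋯ + b_{l-1} y_{l-1})` for independent Bernoulli(`p`)
variables `bᵢ`, defined by revealing one variable at a time. -/
def walk (p : ℝ) (y : ℕ → G) (F : G → ℝ) : ℕ → G → ℝ
  | 0 => F
  | l + 1 => fun t => (1 - p) * walk p y F l t + p * walk p y F l (t + y l)

/-- The mean of `F` over the window `t, t + 1, …, t + s - 1`. -/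
noncomputable def windowMean {q : ℕ} (s : ℕ) (F : ZMod q → ℝ) (t : ZMod q) : ℝ :=
  (s : ℝ)⁻¹ * ∑ b ∈ range s, F (t + (b : ZMod q))

variable {p : ℝ} {y : ℕ → G} {F : G → ℝ}

lemma walk_succ (p : ℝ) (y : ℕ → G) (F : G → ℝ) (l : ℕ) (t : G) :
    walk p y F (l + 1) t = (1 - p) * walk p y F l t + p * walk p y F l (t + y l) := rfl

lemma walk_add (p : ℝ) (y : ℕ → G) (F : G → ℝ) (k l : ℕ) :
    walk p y F (k + l) = walk p (fun i => y (k + i)) (walk p y F k) l := by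
  induction l with
  | zero => rfl
  | succ l ih =>
    funext t
    rw [← add_assoc, walk_succ, walk_succ, ih]

lemma walk_congr {y' : ℕ → G} {l : ℕ} (h : ∀ i < l, y i = y' i) :
    walk p y F l = walk p y' F l := by
  induction l with
  | zero => rfl
  | succ l ih =>
    funext t
    rw [walk_succ, walk_succ, ih fun i hi => h i (by omega), h l (by omega)]

lemma walk_nonneg (hp0 : 0 ≤ p) (hp1 : p ≤ 1) (hF : ∀ t, 0 ≤ F t) (l : ℕ) (t : G) :
    0 ≤ walk p y F l t := by
  induction l generalizing t with
  | zero => exact hF t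
  | succ l ih =>
    exact add_nonneg (mul_nonneg (by linarith) (ih _)) (mul_nonneg hp0 (ih _))

lemma walk_le (hp0 : 0 ≤ p) (hp1 : p ≤ 1) {c : ℝ} (hF : ∀ t, F t ≤ c) (l : ℕ) (t : G) :
    walk p y F l t ≤ c := by
  induction l generalizing t with
  | zero => exact hF t
  | succ l ih =>
    rw [walk_succ]
    nlinarith [ih t, ih (t + y l)]

lemma sum_comp_add_right [Fintype G] (F : G → ℝ) (a : G) : ∑ t, F (t + a) = ∑ t, F t :=
  Equiv.sum_comp (Equiv.addRight a) F

lemma sum_walk [Fintype G] (l : ℕ) : ∑ t, walk p y F l t = ∑ t, F t := by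
  induction l with
  | zero => rfl
  | succ l ih =>
    simp only [walk_succ, sum_add_distrib, ← mul_sum]
    rw [sum_comp_add_right, ih]
    ring

lemma walk_const_mul (c : ℝ) (l : ℕ) :
    walk p y (fun t => c * F t) l = fun t => c * walk p y F l t := by
  induction l with
  | zero => rfl
  | succ l ih =>
    funext t
    rw [walk_succ, walk_succ, ih]
    ring

lemma walk_sum {ι : Type*} (s : Finset ι) (f : ι → G → ℝ) (l : ℕ) :
    walk p y (fun t => ∑ i ∈ s, f i t) l = fun t => ∑ i ∈ s, walk p y (f i) l t := by
  induction l with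
  | zero => rfl
  | succ l ih =>
    funext t
    simp only [walk_succ, ih, mul_sum, sum_add_distrib]

lemma walk_sub (F F' : G → ℝ) (l : ℕ) :
    walk p y (fun t => F t - F' t) l = fun t => walk p y F l t - walk p y F' l t := by
  induction l with
  | zero => rfl
  | succ l ih =>
    funext t
    simp only [walk_succ, ih]
    ring

lemma walk_translate (a : G) (l : ℕ) :
    walk p y (fun t => F (t + a)) l = fun t => walk p y F l (t + a) := by
  induction l with
  | zero => rfl
  | succ l ih =>
    funext t
    simp only [walk_succ, ih]
    rw [add_right_comm]

lemma sum_walk_sq_le [Fintype G] (hp0 : 0 ≤ p) (hp1 : p ≤ 1) (l : ℕ) :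
    ∑ t, walk p y F l t ^ 2 ≤ ∑ t, F t ^ 2 := by
  induction l with
  | zero => exact le_rfl
  | succ l ih =>
    refine le_trans ?_ ih
    calc ∑ t, walk p y F (l + 1) t ^ 2
        ≤ ∑ t, ((1 - p) * walk p y F l t ^ 2 + p * walk p y F l (t + y l) ^ 2) := by
          refine sum_le_sum fun t _ => ?_
          rw [walk_succ]
          nlinarith [mul_nonneg (mul_nonneg hp0 (sub_nonneg.2 hp1))
            (sq_nonneg (walk p y F l t - walk p y F l (t + y l)))]
      _ = ∑ t, walk p y F l t ^ 2 := by
          simp only [sum_add_distrib, ← mul_sum]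
          rw [sum_comp_add_right (fun t => walk p y F l t ^ 2)]
          ring

/-- The explicit form of the walk as a sum over the possible sets of successes. -/
lemma walk_eq_sum_powerset (l : ℕ) (t : G) :
    walk p y F l t = ∑ S ∈ (range l).powerset,
      p ^ #S * (1 - p) ^ (l - #S) * F (t + ∑ i ∈ S, y i) := by
  induction l generalizing t with
  | zero => simp [walk]
  | succ l ih =>
    rw [walk_succ, ih, ih, range_add_one, sum_powerset_insert notMem_range_self, mul_sum, mul_sum]
    refine congrArg₂ (· + ·) (sum_congr rfl fun S hS => ?_) (sum_congr rfl fun S hS => ?_)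
    · have h : #S ≤ l := by simpa using card_le_card (mem_powerset.1 hS)
      rw [Nat.succ_sub h, pow_succ]
      ring
    · have h : l ∉ S := fun h => by simpa using mem_powerset.1 hS h
      rw [card_insert_of_notMem h, sum_insert h, Nat.succ_sub_succ, pow_succ, add_assoc]
      ring

end Walk

section WindowMean

variable {q : ℕ} {p : ℝ} {y : ℕ → ZMod q} {F : ZMod q → ℝ}

lemma windowMean_nonneg (s : ℕ) (hF : ∀ t, 0 ≤ F t) (t : ZMod q) : 0 ≤ windowMean s F t :=
  mul_nonneg (by positivity) (sum_nonneg fun _ _ => hF _)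

lemma windowMean_le {s : ℕ} {c : ℝ} (hs : 0 < s) (hF : ∀ t, F t ≤ c) (t : ZMod q) :
    windowMean s F t ≤ c := by
  have hs' : (0 : ℝ) < s := by exact_mod_cast hs
  rw [windowMean, inv_mul_le_iff₀ hs']
  calc _ ≤ ∑ b ∈ range s, c := sum_le_sum fun _ _ => hF _
    _ = s * c := by simp

lemma sum_windowMean [NeZero q] {s : ℕ} (hs : 0 < s) : ∑ t, windowMean s F t = ∑ t, F t := by
  have hs' : (s : ℝ) ≠ 0 := by exact_mod_cast hs.ne'
  simp only [windowMean, ← mul_sum]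
  rw [sum_comm]
  simp only [sum_comp_add_right, sum_const, card_range, nsmul_eq_mul]
  field_simp

lemma walk_windowMean (s l : ℕ) :
    walk p y (windowMean s F) l = windowMean s (walk p y F l) := by
  have : windowMean s F = fun t => (s : ℝ)⁻¹ * ∑ b ∈ range s, F (t + (b : ZMod q)) := rfl
  rw [this, walk_const_mul, walk_sum]
  funext t
  simp only [walk_translate, windowMean]

lemma windowMean_comm (s s' : ℕ) :
    windowMean s (windowMean s' F) = windowMean s' (windowMean s F) := by
  funext t
  simp only [windowMean, ← mul_sum]
  rw [sum_comm, mul_left_comm]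
  simp only [add_right_comm]

end WindowMean

/-! ### The path argument -/

section Path

variable {G : Type*} [AddCommGroup G]

/-- Sum over all backward paths of the walk of `T` to the number of bad steps. At step `l` a path
sits at one of the two parents `t`, `t + y l` of `t`, and the step is bad when the walk at
the other parent exceeds `lam`. -/
noncomputable def pathWeight (p : ℝ) (y : ℕ → G) (F : G → ℝ) (lam T : ℝ) : ℕ → G → ℝ
  | 0 => fun _ => 1
  | l + 1 => fun t =>
    pathWeight p y F lam T l t * (if lam < walk p y F l (t + y l) then T else 1) +
      pathWeight p y F lam T l (t + y l) * (if lam < walk p y F l t then T else 1)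

variable {p : ℝ} {y : ℕ → G} {F : G → ℝ} {lam T : ℝ}

lemma pathWeight_succ (l : ℕ) (t : G) : pathWeight p y F lam T (l + 1) t =
    pathWeight p y F lam T l t * (if lam < walk p y F l (t + y l) then T else 1) +
      pathWeight p y F lam T l (t + y l) * (if lam < walk p y F l t then T else 1) := rfl

lemma pathWeight_congr {y' : ℕ → G} {l : ℕ} (h : ∀ i < l, y i = y' i) :
    pathWeight p y F lam T l = pathWeight p y' F lam T l := by
  induction l with
  | zero => rfl
  | succ l ih =>
    funext t
    rw [pathWeight_succ, pathWeight_succ, ih fun i hi => h i (by omega), h l (by omega),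
      walk_congr fun i hi => h i (by omega)]

lemma pathWeight_nonneg (hT : 0 ≤ T) (l : ℕ) (t : G) : 0 ≤ pathWeight p y F lam T l t := by
  induction l generalizing t with
  | zero => exact zero_le_one
  | succ l ih =>
    rw [pathWeight_succ]
    have h1 := ih t
    have h2 := ih (t + y l)
    split_ifs <;> positivity

/-- Following the larger parent back from a point where the walk exceeds `H`, every step that is
not bad costs a factor `1 - p + lam / H`. -/
lemma exists_badSteps (hp0 : 0 ≤ p) (hp : p ≤ 1 / 2) {H B : ℝ} (hlam : 0 ≤ lam) (hH : 0 < H)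
    (hT : 1 ≤ T) (hF : ∀ t, F t ≤ B) (l : ℕ) (t : G) (ht : H < walk p y F l t) :
    ∃ j ≤ l, T ^ j ≤ pathWeight p y F lam T l t ∧
      walk p y F l t ≤ (1 - p + lam / H) ^ (l - j) * B := by
  set ρ := 1 - p + lam / H with hρ
  have hlH : 0 ≤ lam / H := by positivity
  have hρ0 : 0 ≤ ρ := by rw [hρ]; linarith
  have key (a b w : ℝ) (hw : w = (1 - p) * a + p * b ∨ w = (1 - p) * b + p * a) (hab : b ≤ a)
      (hbl : b ≤ lam) (hw' : H < w) : w ≤ ρ * a ∧ H < a ∧ w ≤ a := by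
    have h1 : w ≤ a := by rcases hw with hw | hw <;> nlinarith
    have h2 : H < a := by linarith
    have h3 : lam ≤ lam / H * a := by
      rw [div_mul_eq_mul_div, le_div_iff₀ hH]; nlinarith
    refine ⟨?_, h2, h1⟩
    rw [hρ]
    rcases hw with hw | hw
    · nlinarith
    · nlinarith
  have key2 (a b w : ℝ) (hw : w = (1 - p) * a + p * b ∨ w = (1 - p) * b + p * a) (hab : b ≤ a)
      (hw' : H < w) : H < a ∧ w ≤ a := by
    have h1 : w ≤ a := by rcases hw with hw | hw <;> nlinarith
    exact ⟨by linarith, h1⟩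
  induction l generalizing t with
  | zero => exact ⟨0, le_rfl, by simp [pathWeight], by simpa [walk] using hF t⟩
  | succ l ih =>
    -- `main` treats both parents at once: `u` is the larger one and `v` the other.
    have main (u v : G) (hw : walk p y F (l + 1) t
          = (1 - p) * walk p y F l u + p * walk p y F l v ∨
          walk p y F (l + 1) t = (1 - p) * walk p y F l v + p * walk p y F l u)
        (huv : walk p y F l v ≤ walk p y F l u)
        (hW : pathWeight p y F lam T l u * (if lam < walk p y F l v then T else 1) ≤
          pathWeight p y F lam T (l + 1) t) :
        ∃ j ≤ l + 1, T ^ j ≤ pathWeight p y F lam T (l + 1) t ∧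
          walk p y F (l + 1) t ≤ ρ ^ (l + 1 - j) * B := by
      obtain ⟨hHu, hle⟩ := key2 _ _ _ hw huv ht
      obtain ⟨j, hj, hTj, hB⟩ := ih u hHu
      by_cases hbad : lam < walk p y F l v
      · rw [if_pos hbad] at hW
        refine ⟨j + 1, by omega, le_trans ?_ hW, ?_⟩
        · rw [pow_succ]; gcongr
        · rw [Nat.add_sub_add_right]; linarith
      · rw [if_neg hbad, mul_one] at hW
        refine ⟨j, by omega, hTj.trans hW, ?_⟩
        have := (key _ _ _ hw huv (not_lt.1 hbad) ht).1
        rw [Nat.succ_sub hj, pow_succ]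
        nlinarith
    have hnn (u : G) := pathWeight_nonneg (p := p) (y := y) (F := F) (lam := lam)
      (zero_le_one.trans hT) l u
    rcases le_total (walk p y F l (t + y l)) (walk p y F l t) with h | h
    · refine main t (t + y l) (Or.inl rfl) h ?_
      rw [pathWeight_succ]
      have := hnn (t + y l)
      exact le_add_of_nonneg_right (by split_ifs <;> positivity)
    · refine main (t + y l) t (Or.inr rfl) h ?_
      rw [pathWeight_succ]
      have := hnn t
      exact le_add_of_nonneg_left (by split_ifs <;> positivity)

lemma pow_le_pathWeight (hp0 : 0 ≤ p) (hp : p ≤ 1 / 2) {H B : ℝ} (hlam : 0 ≤ lam) (hH : 0 < H)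
    (hT : 1 ≤ T) (hB : 0 ≤ B) (hF : ∀ t, F t ≤ B) {l s : ℕ} {t : G} (hρ : 1 - p + lam / H ≤ 1)
    (hdecay : (1 - p + lam / H) ^ (l - s) * B ≤ H) (ht : H < walk p y F l t) :
    T ^ s ≤ pathWeight p y F lam T l t := by
  obtain ⟨j, hj, hTj, hw⟩ := exists_badSteps hp0 hp hlam hH hT hF l t ht
  refine le_trans (pow_le_pow_right₀ hT ?_) hTj
  by_contra! hjs
  have h0 : 0 ≤ 1 - p + lam / H := by
    have : 0 ≤ lam / H := by positivity
    linarith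
  have : (1 - p + lam / H) ^ (l - j) ≤ (1 - p + lam / H) ^ (l - s) :=
    pow_le_pow_of_le_one h0 hρ (by omega)
  nlinarith

end Path

/-! ### Averaging over one coordinate of a product set -/

section Resample

variable {n : ℕ} {A : Fin n → Finset ℤ} {E : Finset (Fin n → ℤ)}

/-- On a set closed under resampling of coordinate `i` from `A i`, that coordinate is
uniformly distributed on `A i`, independently of the others. -/
lemma sum_sum_update (i : Fin n) (hEA : ∀ x ∈ E, x i ∈ A i)
    (hE : ∀ x ∈ E, ∀ a ∈ A i, Function.update x i a ∈ E) (Φ : (Fin n → ℤ) → ℝ) :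
    ∑ x ∈ E, ∑ a ∈ A i, Φ (Function.update x i a) = #(A i) * ∑ x ∈ E, Φ x := by
  calc ∑ x ∈ E, ∑ a ∈ A i, Φ (Function.update x i a)
      = ∑ z ∈ E ×ˢ A i, Φ (Function.update z.1 i z.2) := by
        rw [sum_product]
    _ = ∑ z ∈ E ×ˢ A i, Φ z.1 := by
        refine sum_nbij' (fun z => (Function.update z.1 i z.2, z.1 i))
          (fun z => (Function.update z.1 i z.2, z.1 i)) ?_ ?_ ?_ ?_ ?_
        · intro z hz
          rw [mem_product] at hz ⊢
          exact ⟨hE _ hz.1 _ hz.2, hEA _ hz.1⟩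
        · intro z hz
          rw [mem_product] at hz ⊢
          exact ⟨hE _ hz.1 _ hz.2, hEA _ hz.1⟩
        · intro z _; simp
        · intro z _; simp
        · intro z _; rfl
    _ = #(A i) * ∑ x ∈ E, Φ x := by
        rw [sum_product_right]
        simp [nsmul_eq_mul]

/-- The coordinates of an integer vector modulo `q`, continued by zero. -/
def coordMod (q : ℕ) (x : Fin n → ℤ) (i : ℕ) : ZMod q :=
  if h : i < n then ((x ⟨i, h⟩ : ℤ) : ZMod q) else 0

lemma coordMod_update_of_ne {q : ℕ} (x : Fin n → ℤ) (i : Fin n) (a : ℤ) {j : ℕ} (h : j ≠ i) :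
    coordMod q (Function.update x i a) j = coordMod q x j := by
  unfold coordMod
  split_ifs with hj
  · rw [Function.update_of_ne]
    exact fun hh => h (by rw [← hh])
  · rfl

lemma coordMod_val {q : ℕ} (x : Fin n → ℤ) (i : Fin n) : coordMod q x i = (x i : ZMod q) := by
  simp [coordMod]

lemma walk_coordMod_update {q : ℕ} (p : ℝ) (F : ZMod q → ℝ) (x : Fin n → ℤ) (i : Fin n) (a : ℤ)
    {l : ℕ} (h : l ≤ i) :
    walk p (coordMod q (Function.update x i a)) F l = walk p (coordMod q x) F l :=
  walk_congr fun j hj => coordMod_update_of_ne x i a (by omega)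

variable {q : ℕ} [NeZero q]

/-- If at every step only a fraction `τ` of the choices of the new coordinate moves a given point
above `lam`, then the walk exceeds `H` anywhere with probability at most `4 ^ m * q * τ ^ s`, where
`s` is the number of bad steps which may be afforded. -/
theorem card_exists_lt_walk_le {p τ lam H B : ℝ} {l₀ m s : ℕ} (F : ZMod q → ℝ)
    (hp0 : 0 ≤ p) (hp : p ≤ 1 / 2) (hτ0 : 0 < τ) (hτ1 : τ ≤ 1) (hlam : 0 ≤ lam) (hH : 0 < H)
    (hB : 0 ≤ B) (hm : l₀ + m ≤ n)
    (hEA : ∀ x ∈ E, ∀ i, x i ∈ A i)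
    (hE : ∀ x ∈ E, ∀ i : Fin n, l₀ ≤ i → ∀ a ∈ A i, Function.update x i a ∈ E)
    (hsymm : ∀ i, ∀ a ∈ A i, -a ∈ A i)
    (hsup : ∀ x ∈ E, ∀ t, walk p (coordMod q x) F l₀ t ≤ B)
    (hrare : ∀ x ∈ E, ∀ i : Fin n, l₀ ≤ i → ∀ t : ZMod q,
      (#{a ∈ A i | lam < walk p (coordMod q x) F i (t + ((a : ℤ) : ZMod q))} : ℝ) ≤ τ * #(A i))
    (hρ : 1 - p + lam / H ≤ 1) (hdecay : (1 - p + lam / H) ^ (m - s) * B ≤ H) :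
    (#{x ∈ E | ∃ t, H < walk p (coordMod q x) F (l₀ + m) t} : ℝ) ≤ 4 ^ m * q * τ ^ s * #E := by
  set T := τ⁻¹ with hT
  have hT1 : 1 ≤ T := (one_le_inv₀ hτ0).2 hτ1
  have hT0 : 0 ≤ T := zero_le_one.trans hT1
  set y : (Fin n → ℤ) → ℕ → ZMod q := fun x i => coordMod q x (l₀ + i) with hy
  set F' : (Fin n → ℤ) → ZMod q → ℝ := fun x => walk p (coordMod q x) F l₀ with hF'
  set W : (Fin n → ℤ) → ℕ → ZMod q → ℝ := fun x => pathWeight p (y x) (F' x) lam T with hW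
  have hwalk (x l) : walk p (coordMod q x) F (l₀ + l) = walk p (y x) (F' x) l := walk_add ..
  have hW0 (x l t) : 0 ≤ W x l t := pathWeight_nonneg hT0 l t
  have hsum (l : ℕ) (hl : l₀ + l ≤ n) : ∑ x ∈ E, ∑ t, W x l t ≤ 4 ^ l * q * #E := by
    induction l with
    | zero =>
      simp [hW, pathWeight, mul_comm]
    | succ l ih =>
      set i : Fin n := ⟨l₀ + l, by omega⟩ with hi
      have hil : l₀ ≤ i := by simp [hi]
      set f : (Fin n → ℤ) → ZMod q → ℝ := fun x => walk p (coordMod q x) F (l₀ + l) with hf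
      set ω : ℝ → ℝ := fun v => if lam < v then T else 1 with hω
      have hω0 (v) : 0 ≤ ω v := by simp only [hω]; split_ifs <;> linarith
      set Φ : (Fin n → ℤ) → ℤ → ℝ := fun x a =>
        ∑ t, (W x l t * ω (f x (t + (a : ZMod q))) + W x l (t + (a : ZMod q)) * ω (f x t)) with hΦ
      have hfup (x a) : f (Function.update x i a) = f x :=
        walk_coordMod_update p F x i a le_rfl
      have hWup (x a) : W (Function.update x i a) l = W x l := by
        have h1 : F' (Function.update x i a) = F' x := walk_coordMod_update p F x i a hil
        simp only [hW, h1]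
        exact pathWeight_congr fun j hj => coordMod_update_of_ne x i a (by simp [hi]; omega)
      have hstep (x) : ∑ t, W x (l + 1) t = Φ x (x i) := by
        simp only [hΦ]
        refine sum_congr rfl fun t _ => ?_
        have : y x l = (x i : ZMod q) := by simp only [hy]; exact coordMod_val x i
        simp only [hW, pathWeight_succ, this, hω, hf, hwalk]
      have hcard (x) (hx : x ∈ E) (t : ZMod q) :
          ∑ a ∈ A i, ω (f x (t + ((a : ℤ) : ZMod q))) ≤ 2 * #(A i) := by
        have h1 : ∀ v, ω v ≤ 1 + (if lam < v then T else 0) := by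
          intro v; simp only [hω]; split_ifs <;> linarith
        calc _ ≤ ∑ a ∈ A i, (1 + if lam < f x (t + ((a : ℤ) : ZMod q)) then T else 0) :=
              sum_le_sum fun a _ => h1 _
          _ = #(A i) + #{a ∈ A i | lam < f x (t + ((a : ℤ) : ZMod q))} * T := by
              rw [sum_add_distrib, ← sum_filter]
              simp
          _ ≤ #(A i) + (τ * #(A i)) * T := by
              gcongr; exact hrare x hx i hil t
          _ = 2 * #(A i) := by rw [hT]; field_simp; ring
      have hneg (φ : ℤ → ℝ) : ∑ a ∈ A i, φ (-a) = ∑ a ∈ A i, φ a :=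
        sum_nbij' (fun a => -a) (fun a => -a) (fun a ha => hsymm i a ha)
          (fun a ha => hsymm i a ha) (by simp) (by simp) (by simp)
      have hΦ_le (x) (hx : x ∈ E) : ∑ a ∈ A i, Φ x a ≤ 4 * #(A i) * ∑ t, W x l t := by
        have h1 : ∑ a ∈ A i, ∑ t, W x l t * ω (f x (t + ((a : ℤ) : ZMod q)))
            ≤ 2 * #(A i) * ∑ t, W x l t := by
          rw [sum_comm, mul_sum]
          refine sum_le_sum fun t _ => ?_
          rw [← mul_sum, mul_comm]
          exact mul_le_mul_of_nonneg_right (hcard x hx t) (hW0 x l t)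
        have h2 : ∑ a ∈ A i, ∑ t, W x l (t + ((a : ℤ) : ZMod q)) * ω (f x t)
            = ∑ a ∈ A i, ∑ t, W x l t * ω (f x (t + ((a : ℤ) : ZMod q))) := by
          rw [← hneg]
          refine sum_congr rfl fun a _ => ?_
          rw [← sum_comp_add_right _ ((a : ℤ) : ZMod q)]
          refine sum_congr rfl fun t _ => ?_
          simp
        simp only [hΦ, sum_add_distrib, h2]
        linarith
      have hA : (0 : ℝ) ≤ #(A i) := by positivity
      rcases eq_or_lt_of_le hA with h0 | hpos
      · have hEe : E = ∅ := by
          by_contra hne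
          obtain ⟨x, hx⟩ := nonempty_of_ne_empty hne
          have : A i = ∅ := by
            rw [← card_eq_zero]; exact_mod_cast h0.symm
          simpa [this] using hEA x hx i
        simp [hEe]
      · have h3 := sum_sum_update i (fun x hx => hEA x hx i) (fun x hx => hE x hx i hil)
          (fun x => Φ x (x i))
        have h4 (x a) : Φ (Function.update x i a) (Function.update x i a i) = Φ x a := by
          simp only [hΦ, hfup, hWup, Function.update_self]
        simp only [h4] at h3
        have h5 : ∑ x ∈ E, ∑ a ∈ A i, Φ x a ≤ ∑ x ∈ E, 4 * #(A i) * ∑ t, W x l t :=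
          sum_le_sum hΦ_le
        rw [h3, ← mul_sum] at h5
        have h6 : ∑ x ∈ E, Φ x (x i) ≤ 4 * ∑ x ∈ E, ∑ t, W x l t := by
          refine le_of_mul_le_mul_left ?_ hpos
          linarith
        simp only [hstep]
        have := ih (by omega)
        rw [pow_succ]
        linarith
  have hbig (x) (hx : x ∈ E) (t) (ht : H < walk p (coordMod q x) F (l₀ + m) t) :
      T ^ s ≤ ∑ t, W x m t := by
    rw [hwalk] at ht
    refine (pow_le_pathWeight (t := t) hp0 hp hlam hH hT1 hB (hsup x hx) hρ hdecay ht).trans ?_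
    exact single_le_sum (f := fun t => W x m t) (fun t _ => hW0 x m t) (mem_univ t)
  have hfin : #{x ∈ E | ∃ t, H < walk p (coordMod q x) F (l₀ + m) t} * T ^ s
      ≤ 4 ^ m * q * #E := by
    refine le_trans ?_ (hsum m hm)
    rw [← nsmul_eq_mul, ← sum_const]
    refine (sum_le_sum fun x hx => ?_).trans
      (sum_le_sum_of_subset_of_nonneg (filter_subset _ _) fun x _ _ =>
        sum_nonneg fun t _ => hW0 x m t)
    obtain ⟨hx, t, ht⟩ := mem_filter.1 hx
    exact hbig x hx t ht
  have hTs : T ^ s * τ ^ s = 1 := by rw [← mul_pow, hT, inv_mul_cancel₀ hτ0.ne', one_pow]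
  have : 0 < τ ^ s := by positivity
  nlinarith

end Resample

/-! ### The Littlewood–Offord–Erdős bound -/

section LittlewoodOfford

lemma card_le_choose_of_isAntichain {J : Finset ℕ} {𝓕 : Finset (Finset ℕ)}
    (hJ : ∀ S ∈ 𝓕, S ⊆ J) (h𝓕 : IsAntichain (· ⊆ ·) (𝓕 : Set (Finset ℕ))) :
    #𝓕 ≤ (#J).choose (#J / 2) := by
  classical
  have hinj : Set.InjOn (fun S : Finset ℕ => S.subtype (· ∈ J)) 𝓕 := by
    intro S hS S' hS' h
    have := congrArg (fun R : Finset {i // i ∈ J} => R.map (Function.Embedding.subtype _)) h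
    simpa [subtype_map, filter_true_of_mem (hJ S hS), filter_true_of_mem (hJ S' hS')] using this
  rw [← card_image_of_injOn hinj]
  have := IsAntichain.sperner (α := {i // i ∈ J})
    (𝒜 := 𝓕.image fun S : Finset ℕ => S.subtype (· ∈ J)) ?_
  · simpa using this
  · intro R hR R' hR' hne hsub
    simp only [coe_image, Set.mem_image] at hR hR'
    obtain ⟨S, hS, rfl⟩ := hR
    obtain ⟨S', hS', rfl⟩ := hR'
    refine h𝓕 hS hS' (fun h => hne (by rw [h])) fun i hi => ?_
    have := @hsub ⟨i, hJ S hS hi⟩ (by simpa using hi)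
    simpa using this

/-- Erdős's bound. Replacing each set by its symmetric difference with the set of the indices of
negative summands reduces it to positive summands, for which the sets form an antichain. -/
lemma card_le_choose_of_abs_sub_lt {J : Finset ℕ} {x : ℕ → ℤ} {N : ℤ} (hx : ∀ i ∈ J, N ≤ |x i|)
    {𝓕 : Finset (Finset ℕ)} (hJ : ∀ S ∈ 𝓕, S ⊆ J)
    (h𝓕 : ∀ S ∈ 𝓕, ∀ S' ∈ 𝓕, |∑ i ∈ S, x i - ∑ i ∈ S', x i| < N) :
    #𝓕 ≤ (#J).choose (#J / 2) := by
  classical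
  set M : Finset ℕ := J.filter fun i => x i < 0 with hM
  have hsum (S : Finset ℕ) (hS : S ⊆ J) :
      ∑ i ∈ symmDiff S M, |x i| = ∑ i ∈ S, x i - ∑ i ∈ M, x i := by
    have hMJ : M ⊆ J := filter_subset _ _
    have hD : symmDiff S M ⊆ J := fun i hi => by
      rcases mem_symmDiff.1 hi with h | h
      · exact hS h.1
      · exact hMJ h.1
    have e (R : Finset ℕ) (hR : R ⊆ J) (f : ℕ → ℤ) :
        ∑ i ∈ R, f i = ∑ i ∈ J, if i ∈ R then f i else 0 := by
      rw [sum_ite_mem, inter_eq_right.2 hR]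
    rw [e _ hD, e _ hS, e _ hMJ, ← sum_sub_distrib]
    refine sum_congr rfl fun i hi => ?_
    have hiM : i ∈ M ↔ x i < 0 := by simp [hM, hi]
    simp only [mem_symmDiff, hiM]
    by_cases h1 : i ∈ S <;> by_cases h2 : x i < 0 <;> simp [h1, h2]
    · exact not_lt.1 h2
    · exact h2.le
  have hinj : Set.InjOn (fun S => symmDiff S M) (𝓕 : Set (Finset ℕ)) :=
    fun S _ S' _ h => symmDiff_left_injective M h
  rw [← card_image_of_injOn hinj]
  refine card_le_choose_of_isAntichain (fun R hR => ?_) ?_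
  · obtain ⟨S, hS, rfl⟩ := mem_image.1 hR
    intro i hi
    rcases mem_symmDiff.1 hi with h | h
    · exact hJ S hS h.1
    · exact (filter_subset _ _) h.1
  · intro R hR R' hR' hne hsub
    simp only [coe_image, Set.mem_image] at hR hR'
    obtain ⟨S, hS, rfl⟩ := hR
    obtain ⟨S', hS', rfl⟩ := hR'
    obtain ⟨i, hi', hi⟩ : ∃ i ∈ symmDiff S' M, i ∉ symmDiff S M := by
      by_contra! h
      exact hne (Subset.antisymm hsub h)
    have hiJ : i ∈ J := by
      rcases mem_symmDiff.1 hi' with h | h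
      · exact hJ S' hS' h.1
      · exact (filter_subset _ _) h.1
    have h1 : ∑ j ∈ symmDiff S M, |x j| + |x i| ≤ ∑ j ∈ symmDiff S' M, |x j| := by
      have h5 : ∑ j ∈ insert i (symmDiff S M), |x j| = |x i| + ∑ j ∈ symmDiff S M, |x j| :=
        sum_insert hi
      rw [add_comm, ← h5]
      exact sum_le_sum_of_subset_of_nonneg (insert_subset hi' hsub) fun _ _ _ => abs_nonneg _
    rw [hsum S (hJ S hS), hsum S' (hJ S' hS')] at h1
    have h2 := h𝓕 S' hS' S hS
    have h3 := hx i hiJ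
    have h4 := le_abs_self (∑ i ∈ S', x i - ∑ i ∈ S, x i)
    linarith

lemma centralBinom_sq_le (m : ℕ) : m.centralBinom ^ 2 * (2 * m + 1) ≤ 16 ^ m := by
  induction m with
  | zero => simp
  | succ m ih =>
    have h := Nat.succ_mul_centralBinom_succ m
    have h2 : (m + 1) ^ 2 * ((m + 1).centralBinom ^ 2 * (2 * (m + 1) + 1)) ≤
        (m + 1) ^ 2 * 16 ^ (m + 1) := by
      calc (m + 1) ^ 2 * ((m + 1).centralBinom ^ 2 * (2 * (m + 1) + 1))
          = ((m + 1) * (m + 1).centralBinom) ^ 2 * (2 * m + 3) := by ring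
        _ = 4 * ((2 * m + 1) * (2 * m + 3)) * (m.centralBinom ^ 2 * (2 * m + 1)) := by
            rw [h]; ring
        _ ≤ 4 * (4 * (m + 1) ^ 2) * 16 ^ m := by
            have h3 : (2 * m + 1) * (2 * m + 3) ≤ 4 * (m + 1) ^ 2 := by nlinarith
            exact Nat.mul_le_mul (Nat.mul_le_mul_left 4 h3) ih
        _ = (m + 1) ^ 2 * 16 ^ (m + 1) := by ring
    exact Nat.le_of_mul_le_mul_left h2 (by positivity)

lemma choose_half_sq_le (j : ℕ) : (j.choose (j / 2)) ^ 2 * (j + 1) ≤ 4 ^ j := by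
  rcases Nat.even_or_odd' j with ⟨m, rfl | rfl⟩
  · have := centralBinom_sq_le m
    rw [Nat.centralBinom_eq_two_mul_choose] at this
    rw [Nat.mul_div_cancel_left _ two_pos, pow_mul]
    exact this
  · have h1 : (2 * m + 1) / 2 = m := by omega
    have h2 : (m + 1).centralBinom = 2 * (2 * m + 1).choose m := by
      rw [Nat.centralBinom_eq_two_mul_choose, show 2 * (m + 1) = (2 * m + 1) + 1 by ring,
        Nat.choose_succ_succ, Nat.choose_symm_half]
      ring
    have h3 := centralBinom_sq_le (m + 1)
    rw [h2] at h3
    rw [h1]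
    have h4 : (16 : ℕ) ^ (m + 1) = 4 * 4 ^ (2 * m + 1) := by
      rw [show (16 : ℕ) = 4 ^ 2 by norm_num, ← pow_mul]; ring
    nlinarith [Nat.zero_le ((2 * m + 1).choose m ^ 2)]

/-- A Bernoulli(`p`) variable with `p ≤ 1 / 2` is a fair coin with probability `2 p` and zero
otherwise. -/
lemma sum_powerset_bernoulli_eq (p : ℝ) (k : ℕ) (φ : Finset ℕ → ℝ) :
    ∑ S ∈ (range k).powerset, p ^ #S * (1 - p) ^ (k - #S) * φ S =
      ∑ J ∈ (range k).powerset, (2 * p) ^ #J * (1 - 2 * p) ^ (k - #J) *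
        ((1 / 2) ^ #J * ∑ S ∈ J.powerset, φ S) := by
  induction k generalizing φ with
  | zero => simp
  | succ k ih =>
    have hcard {S : Finset ℕ} (hS : S ∈ (range k).powerset) : #S ≤ k ∧ k ∉ S :=
      ⟨by simpa using card_le_card (mem_powerset.1 hS),
        fun h => by simpa using mem_powerset.1 hS h⟩
    rw [range_add_one, sum_powerset_insert notMem_range_self,
      sum_powerset_insert notMem_range_self]
    have h1 : ∑ S ∈ (range k).powerset, p ^ #S * (1 - p) ^ (k + 1 - #S) * φ S =
        (1 - p) * ∑ S ∈ (range k).powerset, p ^ #S * (1 - p) ^ (k - #S) * φ S := by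
      rw [mul_sum]
      refine sum_congr rfl fun S hS => ?_
      rw [Nat.succ_sub (hcard hS).1, pow_succ]; ring
    have h2 : ∑ S ∈ (range k).powerset, p ^ #(insert k S) * (1 - p) ^ (k + 1 - #(insert k S)) *
        φ (insert k S) =
        p * ∑ S ∈ (range k).powerset, p ^ #S * (1 - p) ^ (k - #S) * φ (insert k S) := by
      rw [mul_sum]
      refine sum_congr rfl fun S hS => ?_
      rw [card_insert_of_notMem (hcard hS).2, Nat.succ_sub_succ, pow_succ]; ring
    have h3 : ∑ J ∈ (range k).powerset, (2 * p) ^ #J * (1 - 2 * p) ^ (k + 1 - #J) *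
        ((1 / 2) ^ #J * ∑ S ∈ J.powerset, φ S) =
        (1 - 2 * p) * ∑ J ∈ (range k).powerset, (2 * p) ^ #J * (1 - 2 * p) ^ (k - #J) *
        ((1 / 2) ^ #J * ∑ S ∈ J.powerset, φ S) := by
      rw [mul_sum]
      refine sum_congr rfl fun S hS => ?_
      rw [Nat.succ_sub (hcard hS).1, pow_succ]; ring
    have h4 : ∑ J ∈ (range k).powerset, (2 * p) ^ #(insert k J) *
        (1 - 2 * p) ^ (k + 1 - #(insert k J)) *
        ((1 / 2) ^ #(insert k J) * ∑ S ∈ (insert k J).powerset, φ S) =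
        p * ∑ J ∈ (range k).powerset, (2 * p) ^ #J * (1 - 2 * p) ^ (k - #J) *
          ((1 / 2) ^ #J * ∑ S ∈ J.powerset, φ S) +
        p * ∑ J ∈ (range k).powerset, (2 * p) ^ #J * (1 - 2 * p) ^ (k - #J) *
          ((1 / 2) ^ #J * ∑ S ∈ J.powerset, φ (insert k S)) := by
      rw [mul_sum, mul_sum, ← sum_add_distrib]
      refine sum_congr rfl fun S hS => ?_
      rw [card_insert_of_notMem (hcard hS).2, Nat.succ_sub_succ, pow_succ, pow_succ,
        sum_powerset_insert (hcard hS).2]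
      ring
    rw [h1, h2, h3, h4, ih φ, ih fun S => φ (insert k S)]
    ring

/-- The mean of `1 / (B + 1)` for a binomial variable `B`. -/
lemma sum_binomial_div_succ_le {a : ℝ} (ha : 0 < a) (ha1 : a ≤ 1) (k : ℕ) :
    ∑ J ∈ (range k).powerset, a ^ #J * (1 - a) ^ (k - #J) * (1 / ((#J : ℝ) + 1)) ≤
      1 / (a * (k + 1)) := by
  rw [sum_powerset_apply_card (fun j => a ^ j * (1 - a) ^ (k - j) * (1 / ((j : ℝ) + 1))),
    card_range, le_div_iff₀ (by positivity)]
  have h := add_pow a (1 - a) (k + 1)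
  rw [add_sub_cancel, one_pow, sum_range_succ'] at h
  have h1 : (∑ m ∈ range (k + 1), k.choose m • (a ^ m * (1 - a) ^ (k - m) *
      (1 / ((m : ℝ) + 1)))) * (a * (k + 1)) =
      ∑ m ∈ range (k + 1), a ^ (m + 1) * (1 - a) ^ (k + 1 - (m + 1)) * (k + 1).choose (m + 1) := by
    rw [sum_mul]
    refine sum_congr rfl fun m _ => ?_
    have h2 : ((k + 1 : ℕ) : ℝ) * k.choose m = (k + 1).choose (m + 1) * ((m + 1 : ℕ) : ℝ) := by
      exact_mod_cast Nat.add_one_mul_choose_eq k m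
    push_cast at h2
    have h3 : ((m : ℝ) + 1) ≠ 0 := by positivity
    rw [Nat.succ_sub_succ, nsmul_eq_mul, pow_succ]
    field_simp
    linear_combination (1 - a) ^ (k - m) * h2
  have h4 : 0 ≤ (1 - a) ^ (k + 1) := pow_nonneg (by linarith) _
  rw [h1]
  simp only [pow_zero, Nat.sub_zero, one_mul, Nat.choose_zero_right, Nat.cast_one, mul_one] at h
  linarith

/-- A sum of independent `bᵢ xᵢ` with `|xᵢ| ≥ N` falls into a set of diameter less than `N` with
probability `O(k ^ (-1/2))`. -/
theorem sum_bernoulli_le {p : ℝ} (hp0 : 0 < p) (hp : p ≤ 1 / 2) {k : ℕ} {x : ℕ → ℤ} {N : ℤ}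
    (hx : ∀ i < k, N ≤ |x i|) (Q : Finset ℕ → Prop) [DecidablePred Q]
    (hQ : ∀ S ⊆ range k, ∀ S' ⊆ range k, Q S → Q S' → |∑ i ∈ S, x i - ∑ i ∈ S', x i| < N) :
    ∑ S ∈ (range k).powerset, p ^ #S * (1 - p) ^ (k - #S) * (if Q S then 1 else 0) ≤
      1 / √(2 * p * (k + 1)) := by
  rw [sum_powerset_bernoulli_eq]
  set β := √(2 * p * (k + 1)) with hβ
  have hβ0 : 0 < β := Real.sqrt_pos.2 (by positivity)
  have hβ2 : β ^ 2 = 2 * p * (k + 1) := Real.sq_sqrt (by positivity)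
  set w : Finset ℕ → ℝ := fun J => (2 * p) ^ #J * (1 - 2 * p) ^ (k - #J) with hw
  have hw0 (J) : 0 ≤ w J := mul_nonneg (by positivity) (pow_nonneg (by linarith) _)
  have hw1 : ∑ J ∈ (range k).powerset, w J = 1 := by
    have := sum_pow_mul_eq_add_pow (2 * p) (1 - 2 * p) (range k)
    simpa [hw] using this
  have hw2 := sum_binomial_div_succ_le (a := 2 * p) (by positivity) (by linarith) k
  have hc (J : Finset ℕ) (hJ : J ∈ (range k).powerset) :
      (1 / 2 : ℝ) ^ #J * ∑ S ∈ J.powerset, (if Q S then (1 : ℝ) else 0) ≤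
        (β * (1 / ((#J : ℝ) + 1)) + 1 / β) / 2 := by
    set c : ℝ := (1 / 2 : ℝ) ^ #J * ∑ S ∈ J.powerset, (if Q S then (1 : ℝ) else 0) with hcdef
    have h1 : #{S ∈ J.powerset | Q S} ≤ (#J).choose (#J / 2) := by
      refine card_le_choose_of_abs_sub_lt (x := x) (N := N) (fun i hi => hx i ?_)
        (fun S hS => mem_powerset.1 (mem_filter.1 hS).1) fun S hS S' hS' => ?_
      · simpa using mem_powerset.1 hJ hi
      · rw [mem_filter, mem_powerset] at hS hS'
        exact hQ S (hS.1.trans (mem_powerset.1 hJ)) S' (hS'.1.trans (mem_powerset.1 hJ)) hS.2 hS'.2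
    have h2 : c = (1 / 2) ^ #J * (#{S ∈ J.powerset | Q S} : ℝ) := by
      rw [hcdef, sum_boole]
    have h3 : (#{S ∈ J.powerset | Q S} : ℝ) ^ 2 * ((#J : ℝ) + 1) ≤ 4 ^ #J := by
      have h4 : (((#J).choose (#J / 2) : ℕ) : ℝ) ^ 2 * ((#J : ℝ) + 1) ≤ 4 ^ #J := by
        exact_mod_cast choose_half_sq_le #J
      refine le_trans ?_ h4
      gcongr
    have h5 : c ^ 2 ≤ 1 / ((#J : ℝ) + 1) := by
      rw [le_div_iff₀ (by positivity), h2, mul_pow, mul_assoc]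
      calc ((1 / 2 : ℝ) ^ #J) ^ 2 * _ ≤ ((1 / 2 : ℝ) ^ #J) ^ 2 * 4 ^ #J := by gcongr
        _ = 1 := by rw [← pow_mul, mul_comm #J, pow_mul, ← mul_pow]; norm_num
    -- the inequality of arithmetic and geometric means, sharp for `c = 1 / β`
    have h6 : 2 * c ≤ β * c ^ 2 + 1 / β := by
      have : 0 ≤ (β * c - 1) ^ 2 / β := by positivity
      have h7 : (β * c - 1) ^ 2 / β = β * c ^ 2 - 2 * c + 1 / β := by field_simp; ring
      linarith
    nlinarith
  calc _ ≤ ∑ J ∈ (range k).powerset, w J * ((β * (1 / ((#J : ℝ) + 1)) + 1 / β) / 2) :=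
        sum_le_sum fun J hJ => mul_le_mul_of_nonneg_left (hc J hJ) (hw0 J)
    _ = (β * ∑ J ∈ (range k).powerset, w J * (1 / ((#J : ℝ) + 1)) +
          (1 / β) * ∑ J ∈ (range k).powerset, w J) / 2 := by
        rw [mul_sum, mul_sum, ← sum_add_distrib, sum_div]
        exact sum_congr rfl fun J _ => by ring
    _ ≤ (β * (1 / (2 * p * (k + 1))) + (1 / β) * 1) / 2 := by rw [hw1]; gcongr
    _ = 1 / β := by rw [← hβ2]; field_simp; ring

/-- The point mass at the origin. -/
def pointMass {q : ℕ} (t : ZMod q) : ℝ := if t = 0 then 1 else 0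

/-- The Littlewood–Offord bound modulo `q`, where `q` is so large that the sums do not wrap
around. -/
theorem windowMean_walk_pointMass_le {q : ℕ} {p : ℝ} (hp0 : 0 < p) (hp : p ≤ 1 / 2) {k N : ℕ}
    (hN : 0 < N) {D : ℤ} {x : ℕ → ℤ} (hx : ∀ i < k, (N : ℤ) ≤ |x i|)
    (hD : ∑ i ∈ range k, |x i| ≤ D) (hq : 2 * D + N ≤ q)
    (y : ℕ → ZMod q) (hy : ∀ i < k, y i = (x i : ZMod q)) (t : ZMod q) :
    windowMean N (walk p y pointMass k) t ≤ (N : ℝ)⁻¹ * (1 / √(2 * p * (k + 1))) := by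
  classical
  have hD0 : 0 ≤ D := le_trans (sum_nonneg fun _ _ => abs_nonneg _) hD
  set Q : Finset ℕ → Prop := fun S => ∃ b < N, t + ((b : ℕ) : ZMod q) + ∑ i ∈ S, y i = 0 with hQ
  have hcast (S : Finset ℕ) (hS : S ⊆ range k) :
      ∑ i ∈ S, y i = ((∑ i ∈ S, x i : ℤ) : ZMod q) := by
    rw [Int.cast_sum]
    exact sum_congr rfl fun i hi => hy i (by simpa using hS hi)
  have habs (S : Finset ℕ) (hS : S ⊆ range k) : |∑ i ∈ S, x i| ≤ D :=
    (abs_sum_le_sum_abs _ _).trans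
      ((sum_le_sum_of_subset_of_nonneg hS fun _ _ _ => abs_nonneg _).trans hD)
  -- there is no wrap-around: all integers met below have absolute value less than `q`
  have hzero (z : ℤ) (hz : |z| < q) (h : ((z : ℤ) : ZMod q) = 0) : z = 0 :=
    Int.eq_zero_of_abs_lt_dvd ((ZMod.intCast_zmod_eq_zero_iff_dvd z q).1 h) hz
  have hmain := sum_bernoulli_le hp0 hp hx Q ?_
  · refine mul_le_mul_of_nonneg_left (le_trans ?_ hmain) (by positivity)
    simp only [walk_eq_sum_powerset]
    rw [sum_comm]
    refine sum_le_sum fun S hS => ?_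
    rw [← mul_sum]
    refine mul_le_mul_of_nonneg_left ?_
      (mul_nonneg (by positivity) (pow_nonneg (by linarith) _))
    by_cases h : Q S
    · rw [if_pos h]
      simp only [pointMass, sum_boole]
      have : #{b ∈ range N | t + ((b : ℕ) : ZMod q) + ∑ i ∈ S, y i = 0} ≤ 1 := by
        refine card_le_one.2 fun b hb b' hb' => ?_
        rw [mem_filter, mem_range] at hb hb'
        have h1 : (((b : ℤ) - b' : ℤ) : ZMod q) = 0 := by
          push_cast
          linear_combination hb.2 - hb'.2
        have := hzero _ (by rw [abs_lt]; constructor <;> omega) h1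
        omega
      exact_mod_cast this
    · rw [if_neg h]
      refine (sum_eq_zero fun b hb => ?_).le
      rw [pointMass, if_neg fun h' => h ⟨b, mem_range.1 hb, h'⟩]
  · rintro S hS S' hS' ⟨b, hb, h⟩ ⟨b', hb', h'⟩
    have h1 : ((∑ i ∈ S, x i - ∑ i ∈ S', x i - ((b' : ℤ) - b) : ℤ) : ZMod q) = 0 := by
      rw [hcast S hS] at h
      rw [hcast S' hS'] at h'
      push_cast at h h' ⊢
      linear_combination h - h'
    have h2 := abs_le.1 (habs S hS)
    have h3 := abs_le.1 (habs S' hS')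
    have := hzero _ (by rw [abs_lt]; constructor <;> omega) h1
    rw [abs_lt]
    constructor <;> omega

end LittlewoodOfford

/-! ### Unions of two integer intervals -/

section Intervals

/-- A set of integers which is a union of two integer intervals. -/
def IsTwoIntervals (A : Finset ℤ) : Prop :=
  ∃ I J : Finset ℤ, IsIntegerInterval I ∧ IsIntegerInterval J ∧ A = I ∪ J

variable {q : ℕ} {N : ℕ} {c : ℝ} {g : ZMod q → ℝ}

lemma sum_range_le_of_windowMean_le (hN : 0 < N) (hg : ∀ t, 0 ≤ g t)
    (hc : ∀ t, windowMean N g t ≤ c) (M : ℕ) (t : ZMod q) :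
    ∑ j ∈ range M, g (t + (j : ZMod q)) ≤ (M + N) * c := by
  have hN' : (0 : ℝ) < N := by exact_mod_cast hN
  have hc0 : 0 ≤ c := (windowMean_nonneg N hg 0).trans (hc 0)
  have hblock (t) : ∑ b ∈ range N, g (t + (b : ZMod q)) ≤ N * c := by
    have := hc t
    rwa [windowMean, inv_mul_le_iff₀ hN'] at this
  have hblocks (m : ℕ) : ∑ j ∈ range (m * N), g (t + (j : ZMod q)) ≤ m * (N * c) := by
    induction m with
    | zero => simp
    | succ m ih =>
      rw [Nat.succ_mul, sum_range_add]
      have := hblock (t + ((m * N : ℕ) : ZMod q))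
      simp only [Nat.cast_add, ← add_assoc] at this ⊢
      push_cast at this ih ⊢
      linarith
  have h1 : M ≤ (M / N + 1) * N := by
    have := Nat.lt_div_mul_add (a := M) hN
    rw [Nat.succ_mul]; omega
  have h2 : (((M / N + 1 : ℕ) : ℝ)) * N ≤ M + N := by
    have := Nat.div_mul_le_self M N
    have h3 : ((M / N : ℕ) : ℝ) * N ≤ M := by exact_mod_cast this
    push_cast; linarith
  calc _ ≤ ∑ j ∈ range ((M / N + 1) * N), g (t + (j : ZMod q)) :=
        sum_le_sum_of_subset_of_nonneg (range_mono h1) fun _ _ _ => hg _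
    _ ≤ _ := hblocks _
    _ = ((M / N + 1 : ℕ) : ℝ) * N * c := by ring
    _ ≤ _ := by gcongr

lemma sum_interval_le_of_windowMean_le (hN : 0 < N) (hg : ∀ t, 0 ≤ g t)
    (hc : ∀ t, windowMean N g t ≤ c) {I : Finset ℤ} (hI : IsIntegerInterval I) (t : ZMod q) :
    ∑ a ∈ I, g (t + ((a : ℤ) : ZMod q)) ≤ (#I + N) * c := by
  obtain ⟨u, v, rfl⟩ := hI
  have h : ∑ a ∈ Icc u v, g (t + ((a : ℤ) : ZMod q)) =
      ∑ j ∈ range #(Icc u v), g (t + (u : ZMod q) + (j : ZMod q)) := by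
    rw [Int.card_Icc]
    refine sum_nbij' (fun a => (a - u).toNat) (fun j => u + j) ?_ ?_ ?_ ?_ ?_
    · intro a ha; simp only [mem_Icc, mem_range] at *; omega
    · intro a ha; simp only [mem_Icc, mem_range] at *; omega
    · intro a ha; simp only [mem_Icc] at *; omega
    · intro a ha; simp
    · intro a ha
      rw [mem_Icc] at ha
      have : (((a - u).toNat : ℤ) : ZMod q) = ((a - u : ℤ) : ZMod q) := by
        rw [Int.toNat_of_nonneg (by omega)]
      rw [Int.cast_natCast] at this
      rw [this, add_assoc]
      push_cast
      rw [add_sub_cancel]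
  rw [h]
  exact sum_range_le_of_windowMean_le hN hg hc _ _

/-- If the means of `g` over windows of length `N` are at most `c`, then `g` exceeds `lam` only on
a fraction `3 c / lam` of a translate of `A`. -/
lemma card_lt_le_of_windowMean_le (hN : 0 < N) (hg : ∀ t, 0 ≤ g t)
    (hc : ∀ t, windowMean N g t ≤ c) {A : Finset ℤ} (hA : IsTwoIntervals A) (hcard : 2 * N ≤ #A)
    {lam : ℝ} (hlam : 0 < lam) (t : ZMod q) :
    (#{a ∈ A | lam < g (t + ((a : ℤ) : ZMod q))} : ℝ) ≤ 3 * c / lam * #A := by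
  obtain ⟨I, J, hI, hJ, rfl⟩ := hA
  have hc0 : 0 ≤ c := (windowMean_nonneg N hg 0).trans (hc 0)
  have h1 : ∑ a ∈ I ∪ J, g (t + ((a : ℤ) : ZMod q)) ≤ 3 * #(I ∪ J) * c := by
    have h2 : ∑ a ∈ I ∪ J, g (t + ((a : ℤ) : ZMod q)) ≤
        ∑ a ∈ I, g (t + ((a : ℤ) : ZMod q)) + ∑ a ∈ J, g (t + ((a : ℤ) : ZMod q)) := by
      rw [← sum_union_inter]
      exact le_add_of_nonneg_right (sum_nonneg fun _ _ => hg _)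
    have hI' := sum_interval_le_of_windowMean_le hN hg hc hI t
    have hJ' := sum_interval_le_of_windowMean_le hN hg hc hJ t
    have h3 : (#I : ℝ) ≤ #(I ∪ J) := by exact_mod_cast card_le_card subset_union_left
    have h4 : (#J : ℝ) ≤ #(I ∪ J) := by exact_mod_cast card_le_card subset_union_right
    have h5 : (2 * N : ℝ) ≤ #(I ∪ J) := by exact_mod_cast hcard
    have h6 : ((#I : ℝ) + N + (#J + N)) * c ≤ 3 * #(I ∪ J) * c := by gcongr; linarith
    linarith
  have h7 : #{a ∈ I ∪ J | lam < g (t + ((a : ℤ) : ZMod q))} * lam ≤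
      ∑ a ∈ I ∪ J, g (t + ((a : ℤ) : ZMod q)) := by
    rw [← nsmul_eq_mul]
    refine (card_nsmul_le_sum _ _ _ fun a ha => (mem_filter.1 ha).2.le).trans ?_
    exact sum_le_sum_of_subset_of_nonneg (filter_subset _ _) fun _ _ _ => hg _
  rw [div_mul_eq_mul_div, le_div_iff₀ hlam]
  linarith

lemma card_le_of_forall_mem_Icc {S : Finset ℤ} {x y : ℝ} (hxy : x ≤ y)
    (h : ∀ a ∈ S, x ≤ a ∧ (a : ℝ) ≤ y) : (#S : ℝ) ≤ y - x + 1 := by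
  have hS : S ⊆ Icc ⌈x⌉ ⌊y⌋ := fun a ha =>
    mem_Icc.2 ⟨Int.ceil_le.2 (h a ha).1, Int.le_floor.2 (h a ha).2⟩
  have h1 : (#S : ℝ) ≤ #(Icc ⌈x⌉ ⌊y⌋) := by exact_mod_cast card_le_card hS
  refine h1.trans ?_
  rw [Int.card_Icc]
  have h2 : (((⌊y⌋ + 1 - ⌈x⌉).toNat : ℤ) : ℝ) = (max (⌊y⌋ + 1 - ⌈x⌉) 0 : ℤ) := by
    rw [Int.toNat_eq_max]
  rw [Int.cast_natCast] at h2
  rw [h2]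
  push_cast
  refine max_le ?_ (by linarith)
  have := Int.floor_le y
  have := Int.le_ceil x
  linarith

/-- `a α` lies within `r` of an integer. -/
def NearInt (α r : ℝ) (a : ℤ) : Prop := ∃ m : ℤ, |(a : ℝ) * α - m| < r

open Classical in
lemma card_nearInt_interval_le {α r : ℝ} (hα : 0 < α) (hr : 0 < r) (hr2 : r ≤ 1 / 2)
    {I : Finset ℤ} (hI : IsIntegerInterval I) :
    (#{a ∈ I | NearInt α r a} : ℝ) ≤ (#I * α + 2) * (2 * r / α + 1) := by
  obtain ⟨u, v, rfl⟩ := hI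
  rcases lt_or_ge v u with huv | huv
  · rw [Icc_eq_empty (by omega)]
    simp only [filter_empty, card_empty, Nat.cast_zero]
    positivity
  have hcardI : (#(Icc u v) : ℝ) = v - u + 1 := by
    rw [Int.card_Icc]
    have : (((v + 1 - u).toNat : ℤ) : ℝ) = ((v + 1 - u : ℤ) : ℝ) := by
      rw [Int.toNat_of_nonneg (by omega)]
    rw [Int.cast_natCast] at this
    rw [this]; push_cast; ring
  have hround {a m : ℤ} (h : |(a : ℝ) * α - m| < r) : round ((a : ℝ) * α) = m := by
    rw [round_eq, Int.floor_eq_iff]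
    rw [abs_lt] at h
    constructor <;> linarith [h.1, h.2]
  set S := {a ∈ Icc u v | NearInt α r a} with hS
  set M := S.image fun a : ℤ => round ((a : ℝ) * α) with hM
  have h1 : (#M : ℝ) ≤ ((v * α + r) - (u * α - r)) + 1 := by
    refine card_le_of_forall_mem_Icc ?_ fun m hm => ?_
    · have : (u : ℝ) ≤ v := by exact_mod_cast huv
      nlinarith
    · obtain ⟨a, ha, rfl⟩ := mem_image.1 hm
      obtain ⟨ha, m, hm⟩ := mem_filter.1 ha
      rw [hround hm]
      rw [mem_Icc] at ha
      have h2 : (u : ℝ) ≤ a := by exact_mod_cast ha.1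
      have h3 : (a : ℝ) ≤ v := by exact_mod_cast ha.2
      rw [abs_lt] at hm
      constructor <;> nlinarith [hm.1, hm.2]
  have h4 (m : ℤ) : (#(S.filter fun a : ℤ => round ((a : ℝ) * α) = m) : ℝ) ≤ 2 * r / α + 1 := by
    have h2 : (m + r) / α - (m - r) / α + 1 = 2 * r / α + 1 := by rw [← sub_div]; ring
    have h3 : ((m : ℝ) - r) / α ≤ (m + r) / α := by gcongr; linarith
    rw [← h2]
    refine card_le_of_forall_mem_Icc (S := S.filter fun a : ℤ => round ((a : ℝ) * α) = m) h3 fun a ha => ?_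
    obtain ⟨haS, ham⟩ := mem_filter.1 ha
    obtain ⟨-, m', hm'⟩ := mem_filter.1 haS
    have hmm : m' = m := (hround hm').symm.trans ham
    rw [hmm, abs_lt] at hm'
    rw [div_le_iff₀ hα, le_div_iff₀ hα]
    constructor <;> linarith [hm'.1, hm'.2]
  have h5 : (#S : ℝ) = ∑ m ∈ M, (#(S.filter fun a : ℤ => round ((a : ℝ) * α) = m) : ℝ) := by
    exact_mod_cast card_eq_sum_card_image (fun a : ℤ => round ((a : ℝ) * α)) S
  have h6 : (0 : ℝ) ≤ 2 * r / α + 1 := by positivity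
  calc (#S : ℝ) ≤ ∑ m ∈ M, (2 * r / α + 1) := h5 ▸ sum_le_sum fun m _ => h4 m
    _ = #M * (2 * r / α + 1) := by rw [sum_const, nsmul_eq_mul]
    _ ≤ _ := by
      gcongr
      rw [hcardI]
      nlinarith

open Classical in
/-- The multiples of `α` by the elements of `A` are about as often close to integers as uniformly
distributed points of the circle would be. -/
lemma card_nearInt_le {α r : ℝ} (hα : 0 < α) (hr : 0 < r) (hr2 : r ≤ 1 / 2) {A : Finset ℤ}
    (hA : IsTwoIntervals A) (hN : 0 < N) (hcard : 2 * N ≤ #A) :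
    (#{a ∈ A | NearInt α r a} : ℝ) ≤ (2 * (α + 1 / N) * (2 * r / α + 1)) * #A := by
  obtain ⟨I, J, hI, hJ, rfl⟩ := hA
  have hN' : (0 : ℝ) < N := by exact_mod_cast hN
  have h1 : (#{a ∈ I ∪ J | NearInt α r a} : ℝ) ≤
      #{a ∈ I | NearInt α r a} + #{a ∈ J | NearInt α r a} := by
    rw [filter_union]
    exact_mod_cast card_union_le _ _
  have hI' := card_nearInt_interval_le hα hr hr2 hI
  have hJ' := card_nearInt_interval_le hα hr hr2 hJ
  have h3 : (#I : ℝ) ≤ #(I ∪ J) := by exact_mod_cast card_le_card subset_union_left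
  have h4 : (#J : ℝ) ≤ #(I ∪ J) := by exact_mod_cast card_le_card subset_union_right
  have h5 : (2 * N : ℝ) ≤ #(I ∪ J) := by exact_mod_cast hcard
  have h6 : (2 : ℝ) ≤ 1 / N * #(I ∪ J) := by
    rw [one_div, ← div_eq_inv_mul, le_div_iff₀ hN']; linarith
  have h7 : (0 : ℝ) ≤ 2 * r / α + 1 := by positivity
  calc (#{a ∈ I ∪ J | NearInt α r a} : ℝ)
      ≤ (#I * α + 2) * (2 * r / α + 1) + (#J * α + 2) * (2 * r / α + 1) := by linarith
    _ = ((#I + #J) * α + 4) * (2 * r / α + 1) := by ring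
    _ ≤ (2 * (α + 1 / N) * #(I ∪ J)) * (2 * r / α + 1) := by
        gcongr
        nlinarith
    _ = _ := by ring

end Intervals

/-! ### Fourier analysis modulo `q` -/

section Fourier

/-- The distance from `0` of the point `j / q` of the circle `ℝ / ℤ`. -/
noncomputable def frequency {q : ℕ} (j : ZMod q) : ℝ := |(j.valMinAbs : ℝ)| / q

lemma frequency_nonneg {q : ℕ} (j : ZMod q) : 0 ≤ frequency j := by unfold frequency; positivity

variable {q : ℕ} [NeZero q]

/-- The Fourier transform of a real function on `ZMod q`. -/
noncomputable def fourierCoeff (F : ZMod q → ℝ) (j : ZMod q) : ℂ :=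
  ∑ t, ZMod.stdAddChar (-(t * j)) * (F t : ℂ)

lemma frequency_le_half (j : ZMod q) : frequency j ≤ 1 / 2 := by
  have hq : (0 : ℝ) < q := by exact_mod_cast NeZero.pos q
  have h := ZMod.valMinAbs_mem_Ioc j
  have h1 : (-(q : ℝ)) < j.valMinAbs * 2 := by exact_mod_cast h.1
  have h2 : (j.valMinAbs : ℝ) * 2 ≤ q := by exact_mod_cast h.2
  rw [frequency, div_le_iff₀ hq, abs_le]
  constructor <;> linarith

lemma norm_stdAddChar (j : ZMod q) : ‖(ZMod.stdAddChar j : ℂ)‖ = 1 := AddChar.norm_apply _ _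

lemma norm_stdAddChar_sub_one (a : ℤ) (j : ZMod q) :
    ‖(ZMod.stdAddChar ((a : ZMod q) * j) : ℂ) - 1‖ = 2 * |Real.sin (Real.pi * (a * frequency j))| := by
  have h : ((a : ZMod q) * j) = ((a * j.valMinAbs : ℤ) : ZMod q) := by
    rw [Int.cast_mul, ZMod.coe_valMinAbs]
  have h2 : (2 * (Real.pi : ℂ) * Complex.I * ((a * j.valMinAbs : ℤ) : ℂ) / (q : ℂ)) =
      Complex.I * ((2 * (Real.pi * (a * (j.valMinAbs / q))) : ℝ) : ℂ) := by
    push_cast; ring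
  rw [h, ZMod.stdAddChar_coe, h2, Complex.norm_exp_I_mul_ofReal_sub_one, norm_mul,
    mul_div_cancel_left₀ _ (two_ne_zero)]
  simp only [Real.norm_eq_abs, Nat.abs_ofNat]
  congr 1
  rw [frequency]
  rcases abs_cases (j.valMinAbs : ℝ) with ⟨hc, -⟩ | ⟨hc, -⟩
  · rw [hc]
  · rw [hc, neg_div, mul_neg, mul_neg, Real.sin_neg, abs_neg]

lemma sum_norm_fourierCoeff_sq (F : ZMod q → ℝ) :
    ∑ j, ‖fourierCoeff F j‖ ^ 2 = q * ∑ t, F t ^ 2 := by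
  have key : ∑ j, (fourierCoeff F j * (starRingEnd ℂ) (fourierCoeff F j)) =
      (q : ℂ) * ∑ t, (F t : ℂ) ^ 2 := by
    have hconj (j : ZMod q) : (starRingEnd ℂ) (fourierCoeff F j) =
        ∑ t, ZMod.stdAddChar (t * j) * (F t : ℂ) := by
      rw [fourierCoeff, map_sum]
      refine sum_congr rfl fun t _ => ?_
      rw [map_mul, Complex.conj_ofReal, ← AddChar.map_neg_eq_conj, neg_neg]
    have hj (j : ZMod q) : fourierCoeff F j * (starRingEnd ℂ) (fourierCoeff F j) =
        ∑ t, ∑ s, (F t * F s : ℂ) * ZMod.stdAddChar (j * (s - t)) := by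
      rw [hconj, fourierCoeff, sum_mul_sum]
      refine sum_congr rfl fun t _ => sum_congr rfl fun s _ => ?_
      rw [show j * (s - t) = -(t * j) + s * j by ring, AddChar.map_add_eq_mul]
      ring
    simp only [hj]
    rw [sum_comm, mul_sum]
    refine sum_congr rfl fun t _ => ?_
    rw [sum_comm]
    have hs (s : ZMod q) : ∑ j, (F t * F s : ℂ) * ZMod.stdAddChar (j * (s - t)) =
        if s = t then (q : ℂ) * (F t) ^ 2 else 0 := by
      rw [← mul_sum, AddChar.sum_mulShift _ (ZMod.isPrimitive_stdAddChar q)]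
      by_cases h : s = t
      · subst h; simp; ring
      · simp [h, sub_eq_zero]
    simp [hs]
  have h2 : (((∑ j, ‖fourierCoeff F j‖ ^ 2 : ℝ)) : ℂ) = ((q * ∑ t, F t ^ 2 : ℝ) : ℂ) := by
    push_cast
    rw [← key]
    exact sum_congr rfl fun j _ => (Complex.mul_conj' _).symm
  exact_mod_cast h2

lemma fourierCoeff_translate (F : ZMod q → ℝ) (a j : ZMod q) :
    fourierCoeff (fun t => F (t + a)) j = ZMod.stdAddChar (a * j) * fourierCoeff F j := by
  rw [fourierCoeff, fourierCoeff, mul_sum, ← Equiv.sum_comp (Equiv.addRight a)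
    (fun t => ZMod.stdAddChar (a * j) * (ZMod.stdAddChar (-(t * j)) * (F t : ℂ)))]
  refine sum_congr rfl fun t _ => ?_
  rw [← mul_assoc, ← AddChar.map_add_eq_mul, Equiv.coe_addRight]
  congr 2
  ring

lemma fourierCoeff_walk (p : ℝ) (y : ℕ → ZMod q) (F : ZMod q → ℝ) (l : ℕ) (j : ZMod q) :
    fourierCoeff (walk p y F l) j =
      (∏ i ∈ range l, (1 - p + p * ZMod.stdAddChar (y i * j) : ℂ)) * fourierCoeff F j := by
  induction l with
  | zero => simp [walk]
  | succ l ih =>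
    have h : fourierCoeff (walk p y F (l + 1)) j =
        (1 - p) * fourierCoeff (walk p y F l) j +
          p * fourierCoeff (fun t => walk p y F l (t + y l)) j := by
      simp only [fourierCoeff, walk_succ, mul_sum, ← sum_add_distrib]
      refine sum_congr rfl fun t _ => ?_
      push_cast
      ring
    rw [h, fourierCoeff_translate, ih, prod_range_succ]
    ring

/-- The Fourier multiplier of `windowMean s`. -/
noncomputable def windowMultiplier (s : ℕ) (j : ZMod q) : ℂ :=
  (s : ℂ)⁻¹ * ∑ b ∈ range s, ZMod.stdAddChar ((b : ZMod q) * j)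

lemma fourierCoeff_windowMean (s : ℕ) (F : ZMod q → ℝ) (j : ZMod q) :
    fourierCoeff (windowMean s F) j = windowMultiplier s j * fourierCoeff F j := by
  rw [windowMultiplier, mul_assoc, sum_mul]
  simp only [← fourierCoeff_translate]
  simp only [fourierCoeff, windowMean, mul_sum]
  rw [sum_comm]
  refine sum_congr rfl fun t _ => ?_
  push_cast
  simp only [mul_sum]
  exact sum_congr rfl fun b _ => by ring

lemma fourierCoeff_sub (F F' : ZMod q → ℝ) (j : ZMod q) :
    fourierCoeff (fun t => F t - F' t) j = fourierCoeff F j - fourierCoeff F' j := by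
  simp only [fourierCoeff, ← sum_sub_distrib]
  refine sum_congr rfl fun t _ => ?_
  push_cast
  ring

lemma norm_windowMultiplier_le_one {s : ℕ} (hs : 0 < s) (j : ZMod q) :
    ‖windowMultiplier s j‖ ≤ 1 := by
  have hs' : (0 : ℝ) < s := by exact_mod_cast hs
  rw [windowMultiplier, norm_mul, norm_inv, Complex.norm_natCast, inv_mul_le_iff₀ hs', mul_one]
  refine (norm_sum_le _ _).trans ?_
  simp

lemma norm_one_sub_windowMultiplier_le {s : ℕ} (hs : 0 < s) (j : ZMod q) :
    ‖1 - windowMultiplier s j‖ ≤ 2 * Real.pi * s * frequency j := by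
  have hs' : (0 : ℝ) < s := by exact_mod_cast hs
  have hs'' : (s : ℂ) ≠ 0 := by exact_mod_cast hs.ne'
  have h : 1 - windowMultiplier s j =
      (s : ℂ)⁻¹ * ∑ b ∈ range s, (1 - ZMod.stdAddChar ((b : ZMod q) * j)) := by
    rw [windowMultiplier, sum_sub_distrib, mul_sub]
    simp [hs'']
  rw [h, norm_mul, norm_inv, Complex.norm_natCast, inv_mul_le_iff₀ hs']
  refine (norm_sum_le _ _).trans ?_
  calc _ ≤ ∑ b ∈ range s, 2 * Real.pi * s * frequency j := by
        refine sum_le_sum fun b hb => ?_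
        have hb' : (b : ℝ) ≤ s := by exact_mod_cast (mem_range.1 hb).le
        have h1 := norm_stdAddChar_sub_one (b : ℤ) j
        rw [Int.cast_natCast, Int.cast_natCast] at h1
        rw [norm_sub_rev, h1]
        have hf := frequency_nonneg j
        have h2 : |Real.sin (Real.pi * (b * frequency j))| ≤ Real.pi * (b * frequency j) := by
          refine Real.abs_sin_le_abs.trans_eq (abs_of_nonneg ?_)
          have := Real.pi_pos
          positivity
        have h3 : (b : ℝ) * frequency j ≤ s * frequency j := by gcongr
        nlinarith [Real.pi_pos]
    _ = _ := by simp

lemma norm_windowMultiplier_le {s : ℕ} (hs : 0 < s) {j : ZMod q} (hj : 0 < frequency j) :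
    ‖windowMultiplier s j‖ ≤ 1 / (2 * s * frequency j) := by
  have hs' : (0 : ℝ) < s := by exact_mod_cast hs
  set z : ℂ := ZMod.stdAddChar j with hz
  have hz1 : 4 * frequency j ≤ ‖z - 1‖ := by
    have h1 := norm_stdAddChar_sub_one 1 j
    rw [Int.cast_one, Int.cast_one, one_mul, one_mul] at h1
    rw [h1]
    have h2 := Real.mul_abs_le_abs_sin (x := Real.pi * frequency j) (by
      rw [abs_of_nonneg (by have := Real.pi_pos; positivity)]
      nlinarith [frequency_le_half j, Real.pi_pos])
    rw [abs_of_nonneg (a := Real.pi * frequency j) (by have := Real.pi_pos; positivity)] at h2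
    have h3 : 2 / Real.pi * (Real.pi * frequency j) = 2 * frequency j := by
      field_simp [Real.pi_ne_zero]
    linarith
  have hz0 : 0 < ‖z - 1‖ := by linarith
  have hne : z ≠ 1 := fun h => by simp [h] at hz0
  have hpow (b : ℕ) : (ZMod.stdAddChar ((b : ZMod q) * j) : ℂ) = z ^ b := by
    rw [hz, ← AddChar.map_nsmul_eq_pow, nsmul_eq_mul]
  have hgeom : ‖∑ b ∈ range s, z ^ b‖ ≤ 2 / ‖z - 1‖ := by
    rw [geom_sum_eq hne, norm_div]
    gcongr
    refine (norm_sub_le _ _).trans ?_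
    rw [norm_pow, hz, norm_stdAddChar]
    norm_num
  rw [windowMultiplier, norm_mul, norm_inv, Complex.norm_natCast]
  simp only [hpow]
  calc (s : ℝ)⁻¹ * ‖∑ b ∈ range s, z ^ b‖ ≤ (s : ℝ)⁻¹ * (2 / (4 * frequency j)) := by
        gcongr
        exact hgeom.trans (by gcongr)
    _ = _ := by field_simp; norm_num

lemma norm_bernoulli_sq (p : ℝ) {z : ℂ} (hz : ‖z‖ = 1) :
    ‖1 - p + p * z‖ ^ 2 = 1 - p * (1 - p) * ‖z - 1‖ ^ 2 := by
  have h : z.re * z.re + z.im * z.im = 1 := by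
    rw [← Complex.normSq_apply, ← Complex.sq_norm, hz, one_pow]
  rw [Complex.sq_norm, Complex.sq_norm, Complex.normSq_apply, Complex.normSq_apply]
  simp
  linear_combination (p ^ 2 + p * (1 - p)) * h

lemma norm_bernoulli_le_one {p : ℝ} (hp0 : 0 ≤ p) (hp1 : p ≤ 1) {z : ℂ} (hz : ‖z‖ = 1) :
    ‖1 - p + p * z‖ ≤ 1 := by
  have h := norm_bernoulli_sq p hz
  have h1 : 0 ≤ p * (1 - p) * ‖z - 1‖ ^ 2 := by
    have : 0 ≤ 1 - p := by linarith
    positivity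
  nlinarith [norm_nonneg (1 - p + p * z)]

lemma two_mul_le_abs_sin {β r : ℝ} (h : ∀ m : ℤ, r ≤ |β - m|) :
    2 * r ≤ |Real.sin (Real.pi * β)| := by
  have hr := h (round β)
  have h1 : |β - round β| ≤ 1 / 2 := abs_sub_round β
  have h2 : Real.pi * β = Real.pi * (β - round β) + (round β : ℤ) * Real.pi := by ring
  have h3 : |Real.sin (Real.pi * β)| = |Real.sin (Real.pi * (β - round β))| := by
    rw [h2, Real.sin_add_int_mul_pi, abs_mul, abs_zpow, abs_neg, abs_one, one_zpow, one_mul]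
  have h4 := Real.mul_abs_le_abs_sin (x := Real.pi * (β - round β)) (by
    rw [abs_mul, abs_of_pos Real.pi_pos]
    nlinarith [Real.pi_pos])
  rw [abs_mul, abs_of_pos Real.pi_pos, ← mul_assoc, div_mul_cancel₀ _ Real.pi_ne_zero] at h4
  rw [h3]
  linarith

lemma norm_bernoulli_le_exp {p r : ℝ} (hp0 : 0 ≤ p) (hp : p ≤ 1 / 2) (hr : 0 ≤ r) {a : ℤ}
    {j : ZMod q} (h : ¬ NearInt (frequency j) r a) :
    ‖(1 - p + p * ZMod.stdAddChar ((a : ZMod q) * j) : ℂ)‖ ≤ Real.exp (-(4 * p * r ^ 2)) := by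
  have h1 := norm_bernoulli_sq p (norm_stdAddChar ((a : ZMod q) * j))
  have h2 : 2 * r ≤ |Real.sin (Real.pi * (a * frequency j))| :=
    two_mul_le_abs_sin fun m => not_lt.1 fun hm => h ⟨m, hm⟩
  rw [norm_stdAddChar_sub_one] at h1
  have h3 : (2 * r) ^ 2 ≤ |Real.sin (Real.pi * (a * frequency j))| ^ 2 := by gcongr
  have h4 : p / 2 ≤ p * (1 - p) := by nlinarith
  have h5 : (p / 2) * (16 * r ^ 2) ≤
      p * (1 - p) * (2 * |Real.sin (Real.pi * (a * frequency j))|) ^ 2 := by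
    refine mul_le_mul h4 (by nlinarith) (by positivity) (by nlinarith)
  have h6 : 1 - 8 * p * r ^ 2 ≤ Real.exp (-(4 * p * r ^ 2)) ^ 2 := by
    rw [← Real.exp_nat_mul]
    have := Real.add_one_le_exp (((2 : ℕ) : ℝ) * (-(4 * p * r ^ 2)))
    push_cast at this ⊢
    linarith
  refine le_of_sq_le_sq ?_ (Real.exp_pos _).le
  linarith

/-- A walk with many steps `x i` whose multiples of the frequency are not near integers has a small
Fourier multiplier. -/
lemma prod_norm_bernoulli_le {p r : ℝ} (hp0 : 0 ≤ p) (hp : p ≤ 1 / 2) (hr : 0 ≤ r) {l c : ℕ}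
    {x : ℕ → ℤ} {y : ℕ → ZMod q} (hy : ∀ i < l, y i = (x i : ZMod q)) {j : ZMod q}
    [DecidablePred fun i => NearInt (frequency j) r (x i)]
    (hc : #{i ∈ range l | NearInt (frequency j) r (x i)} + c ≤ l) :
    ∏ i ∈ range l, ‖(1 - p + p * ZMod.stdAddChar (y i * j) : ℂ)‖ ≤
      Real.exp (-(4 * p * r ^ 2)) ^ c := by
  set ε := Real.exp (-(4 * p * r ^ 2)) with hε
  have hε1 : ε ≤ 1 := Real.exp_le_one_iff.2 (by have := sq_nonneg r; nlinarith [mul_nonneg hp0 this])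
  have hcard := card_filter_add_card_filter_not (s := range l)
    (fun i => NearInt (frequency j) r (x i))
  rw [card_range] at hcard
  calc ∏ i ∈ range l, ‖(1 - p + p * ZMod.stdAddChar (y i * j) : ℂ)‖
      ≤ ∏ i ∈ range l, (if NearInt (frequency j) r (x i) then 1 else ε) := by
        refine prod_le_prod (fun _ _ => norm_nonneg _) fun i hi => ?_
        rw [hy i (mem_range.1 hi)]
        split_ifs with h
        · exact norm_bernoulli_le_one hp0 (by linarith) (norm_stdAddChar _)
        · exact norm_bernoulli_le_exp hp0 hp hr h
    _ = ε ^ #{i ∈ range l | ¬ NearInt (frequency j) r (x i)} := by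
        rw [prod_ite]; simp
    _ ≤ ε ^ c := pow_le_pow_of_le_one (Real.exp_pos _).le hε1 (by omega)

/-- The difference between a smoothed walk and its mean at scale `N` is small in `L²`. Its Fourier
multiplier is small at frequencies below `α₀` because of the mean, above `α₁` because of the
smoothing, and in between by assumption on the steps of the walk. -/
theorem sum_sq_sub_windowMean_le {p κ α₀ α₁ : ℝ} (hp0 : 0 ≤ p) (hp1 : p ≤ 1) {s N l : ℕ}
    (hs : 0 < s) (hN : 0 < N) (hα₁ : 0 < α₁) (hlow : 2 * Real.pi * N * α₀ ≤ κ)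
    (hhigh : 1 / (s * α₁) ≤ κ) (y : ℕ → ZMod q)
    (hmid : ∀ j : ZMod q, α₀ ≤ frequency j → frequency j ≤ α₁ →
      2 * ∏ i ∈ range l, ‖(1 - p + p * ZMod.stdAddChar (y i * j) : ℂ)‖ ≤ κ)
    (g : ZMod q → ℝ) :
    ∑ t, (windowMean s (walk p y g l) t - windowMean N (windowMean s (walk p y g l)) t) ^ 2 ≤
      κ ^ 2 * ∑ t, g t ^ 2 := by
  have hq : (0 : ℝ) < q := by exact_mod_cast NeZero.pos q
  refine le_of_mul_le_mul_left ?_ hq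
  rw [← sum_norm_fourierCoeff_sq, mul_left_comm, ← sum_norm_fourierCoeff_sq, mul_sum]
  refine sum_le_sum fun j _ => ?_
  rw [fourierCoeff_sub, fourierCoeff_windowMean N, fourierCoeff_windowMean, fourierCoeff_walk]
  set P : ℂ := ∏ i ∈ range l, (1 - p + p * ZMod.stdAddChar (y i * j) : ℂ) with hP
  have hP1 : ‖P‖ ≤ 1 := by
    rw [hP, norm_prod]
    exact prod_le_one (fun _ _ => norm_nonneg _) fun i _ =>
      norm_bernoulli_le_one hp0 hp1 (norm_stdAddChar _)
  have hs1 := norm_windowMultiplier_le_one hs j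
  have hN2 : ‖1 - windowMultiplier N j‖ ≤ 2 := by
    refine (norm_sub_le _ _).trans ?_
    rw [norm_one]
    linarith [norm_windowMultiplier_le_one hN j]
  have hbound : ‖1 - windowMultiplier N j‖ * ‖windowMultiplier s j‖ * ‖P‖ ≤ κ := by
    rcases le_total (frequency j) α₀ with h0 | h0
    · calc _ ≤ ‖1 - windowMultiplier N j‖ * 1 * 1 := by gcongr
        _ ≤ 2 * Real.pi * N * frequency j := by
          rw [mul_one, mul_one]; exact norm_one_sub_windowMultiplier_le hN j
        _ ≤ 2 * Real.pi * N * α₀ := by have := Real.pi_pos; gcongr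
        _ ≤ κ := hlow
    · rcases le_total (frequency j) α₁ with h1 | h1
      · calc _ ≤ 2 * 1 * ‖P‖ := by gcongr
          _ = 2 * ‖P‖ := by ring
          _ ≤ κ := by rw [hP, norm_prod]; exact hmid j h0 h1
      · have hs' : (0 : ℝ) < s := by exact_mod_cast hs
        calc _ ≤ 2 * (1 / (2 * s * frequency j)) * 1 := by
              have hj := norm_windowMultiplier_le hs (hα₁.trans_le h1)
              have h2 : 0 ≤ 1 / (2 * s * frequency j) := (norm_nonneg _).trans hj
              exact mul_le_mul (mul_le_mul hN2 hj (norm_nonneg _) two_pos.le) hP1 (norm_nonneg _)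
                (mul_nonneg two_pos.le h2)
          _ ≤ 2 * (1 / (2 * s * α₁)) * 1 := by gcongr
          _ = 1 / (s * α₁) := by field_simp
          _ ≤ κ := hhigh
  have heq : windowMultiplier s j * (P * fourierCoeff g j) -
      windowMultiplier N j * (windowMultiplier s j * (P * fourierCoeff g j)) =
      ((1 - windowMultiplier N j) * windowMultiplier s j * P) * fourierCoeff g j := by ring
  rw [heq, norm_mul, mul_pow, norm_mul, norm_mul]
  gcongr

end Fourier

/-! ### Few frequencies are resonant -/

section Resonance

variable {n : ℕ} {A : Fin n → Finset ℤ}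

open Classical in
/-- If each coordinate in `C` satisfies `P` with probability at most `τ`, then at least `s` of them
do so with probability at most `2 ^ #C * τ ^ s`. -/
lemma card_many_le (C : Finset (Fin n)) (P : ℤ → Prop) {τ : ℝ} (hτ0 : 0 < τ) (hτ1 : τ ≤ 1)
    (hP : ∀ i ∈ C, (#{a ∈ A i | P a} : ℝ) ≤ τ * #(A i)) (s : ℕ) :
    (#{x ∈ Fintype.piFinset A | s ≤ #{i ∈ C | P (x i)}} : ℝ) ≤
      2 ^ #C * τ ^ s * #(Fintype.piFinset A) := by
  set T := τ⁻¹ with hT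
  have hT1 : 1 ≤ T := (one_le_inv₀ hτ0).2 hτ1
  have hT0 : 0 ≤ T := zero_le_one.trans hT1
  set w : Fin n → ℤ → ℝ := fun i a => if i ∈ C ∧ P a then T else 1 with hw
  have hw0 (i a) : 0 ≤ w i a := by simp only [hw]; split_ifs <;> linarith
  have hprod (x : Fin n → ℤ) : ∏ i, w i (x i) = T ^ #{i ∈ C | P (x i)} := by
    simp only [hw]
    rw [prod_ite]
    simp only [prod_const, one_pow, mul_one]
    congr 2
    ext i; simp
  have hle (i : Fin n) : ∑ a ∈ A i, w i a ≤ (if i ∈ C then 2 else 1) * #(A i) := by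
    by_cases hi : i ∈ C
    · calc ∑ a ∈ A i, w i a ≤ ∑ a ∈ A i, (1 + if P a then T else 0) := by
            refine sum_le_sum fun a _ => ?_
            simp only [hw, hi, true_and]
            split_ifs <;> linarith
        _ = #(A i) + #{a ∈ A i | P a} * T := by
            rw [sum_add_distrib, ← sum_filter]; simp
        _ ≤ #(A i) + (τ * #(A i)) * T := by gcongr; exact hP i hi
        _ = _ := by rw [if_pos hi, hT]; field_simp; ring
    · simp [hw, hi]
  have hsum : ∑ x ∈ Fintype.piFinset A, T ^ #{i ∈ C | P (x i)} ≤
      2 ^ #C * #(Fintype.piFinset A) := by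
    simp only [← hprod]
    rw [← prod_univ_sum]
    refine (prod_le_prod (fun i _ => sum_nonneg fun a _ => hw0 i a) fun i _ => hle i).trans_eq ?_
    rw [prod_mul_distrib, prod_ite_mem, univ_inter, prod_const, Fintype.card_piFinset]
    push_cast
    rfl
  have hfin : #{x ∈ Fintype.piFinset A | s ≤ #{i ∈ C | P (x i)}} * T ^ s ≤
      2 ^ #C * #(Fintype.piFinset A) := by
    refine le_trans ?_ hsum
    rw [← nsmul_eq_mul, ← sum_const]
    refine (sum_le_sum fun x hx => ?_).trans
      (sum_le_sum_of_subset_of_nonneg (filter_subset _ _) fun x _ _ => pow_nonneg hT0 _)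
    exact pow_le_pow_right₀ hT1 (mem_filter.1 hx).2
  have hTs : T ^ s * τ ^ s = 1 := by rw [← mul_pow, hT, inv_mul_cancel₀ hτ0.ne', one_pow]
  have : 0 < τ ^ s := by positivity
  nlinarith

end Resonance

/-! ### From the concentration function to the walk -/

section Levy

variable {Ω : Type*} [MeasurableSpace Ω] {P : Measure Ω} {n : ℕ} {b : Fin n → Ω → ℝ} {p : ℝ}

lemma ae_zero_or_one [IsProbabilityMeasure P] (hp0 : 0 ≤ p) (hp1 : p ≤ 1)
    (hb : IsIIDBernoulli P p b) : ∀ᵐ ω ∂P, ∀ i, b i ω = 0 ∨ b i ω = 1 := by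
  rw [ae_all_iff]
  intro i
  have h1 : MeasurableSet {ω | b i ω = 1} := hb.measurable i (measurableSet_singleton 1)
  have h0 : MeasurableSet {ω | b i ω = 0} := hb.measurable i (measurableSet_singleton 0)
  have hd : Disjoint {ω | b i ω = 0} {ω | b i ω = 1} := by
    rw [Set.disjoint_left]
    intro ω h h'
    exact zero_ne_one (h.symm.trans h')
  have hU : P ({ω | b i ω = 0} ∪ {ω | b i ω = 1}) = 1 := by
    rw [measure_union hd h1, hb.prob_zero, hb.prob_one, ← ENNReal.ofReal_add (by linarith) hp0]
    simp
  have := (prob_compl_eq_zero_iff (h0.union h1)).2 hU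
  rw [ae_iff]
  exact this

lemma prob_eq_indicator_eq [IsProbabilityMeasure P] (hp0 : 0 ≤ p) (hp1 : p ≤ 1)
    (hb : IsIIDBernoulli P p b) {S : Finset ℕ} (hS : S ⊆ range n) :
    P.real {ω | ∀ i : Fin n, b i ω = if (i : ℕ) ∈ S then 1 else 0} =
      p ^ #S * (1 - p) ^ (n - #S) := by
  have h1 : {ω | ∀ i : Fin n, b i ω = if (i : ℕ) ∈ S then 1 else 0} =
      ⋂ i ∈ (univ : Finset (Fin n)), b i ⁻¹' {if (i : ℕ) ∈ S then (1 : ℝ) else 0} := by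
    ext ω; simp
  have h2 := hb.indep.measure_inter_preimage_eq_mul (univ : Finset (Fin n))
    (sets := fun i => {if (i : ℕ) ∈ S then (1 : ℝ) else 0})
    (fun i _ => measurableSet_singleton _)
  have h3 (i : Fin n) : (P (b i ⁻¹' {if (i : ℕ) ∈ S then (1 : ℝ) else 0})).toReal =
      (fun i : ℕ => if i ∈ S then p else 1 - p) i := by
    by_cases h : (i : ℕ) ∈ S
    · have := hb.prob_one i
      simp only [h, if_true]
      rw [← ENNReal.toReal_ofReal hp0, ← this]
      rfl
    · have := hb.prob_zero i
      simp only [h, if_false]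
      rw [← ENNReal.toReal_ofReal (show 0 ≤ 1 - p by linarith), ← this]
      rfl
  rw [measureReal_def, h1, h2, ENNReal.toReal_prod, prod_congr rfl fun i _ => h3 i,
    Fin.prod_univ_eq_prod_range (fun i : ℕ => if i ∈ S then p else 1 - p), prod_ite,
    prod_const, prod_const, filter_mem_eq_inter, inter_eq_right.2 hS, filter_notMem_eq_sdiff,
    card_sdiff_of_subset hS, card_range]

/-- A window of radius `w` contains at most `s` integers when `2 w + 1 ≤ s`, and reducing
modulo `q` can only increase the probability of hitting it. -/
lemma prob_window_le [IsProbabilityMeasure P] (hp0 : 0 ≤ p) (hp1 : p ≤ 1)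
    (hb : IsIIDBernoulli P p b) (x : Fin n → ℤ) (q : ℕ) {s : ℕ} {w : ℝ} (hs : 2 * w + 1 ≤ s)
    (c : ℝ) :
    ∃ t : ZMod q, P.real {ω | |∑ i, b i ω * (x i : ℝ) - c| ≤ w} ≤
      ∑ j ∈ range s, walk p (coordMod q x) pointMass n (t + (j : ZMod q)) := by
  classical
  set X : Finset ℕ → ℤ := fun S => ∑ i : Fin n, if (i : ℕ) ∈ S then x i else 0 with hX
  set good : Finset (Finset ℕ) := {S ∈ (range n).powerset | |(X S : ℝ) - c| ≤ w} with hgood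
  set t : ZMod q := -((⌈c - w⌉ + s - 1 : ℤ) : ZMod q) with ht
  refine ⟨t, ?_⟩
  have hXq (S : Finset ℕ) (hS : S ⊆ range n) : ∑ i ∈ S, coordMod q x i = ((X S : ℤ) : ZMod q) := by
    rw [← inter_eq_right.2 hS, ← sum_ite_mem,
      ← Fin.sum_univ_eq_sum_range (fun i => if i ∈ S then coordMod q x i else 0)]
    simp only [hX, coordMod_val, Int.cast_sum, Int.cast_ite, Int.cast_zero]
    rw [inter_eq_right.2 hS]
  have hsub : {ω | |∑ i, b i ω * (x i : ℝ) - c| ≤ w} ⊆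
      {ω | ¬ ∀ i, b i ω = 0 ∨ b i ω = 1} ∪
        ⋃ S ∈ good, {ω | ∀ i : Fin n, b i ω = if (i : ℕ) ∈ S then 1 else 0} := by
    intro ω hω
    by_cases h : ∀ i, b i ω = 0 ∨ b i ω = 1
    · right
      set S : Finset ℕ := (range n).filter fun i => ∃ h : i < n, b ⟨i, h⟩ ω = 1 with hS
      have hmem (i : Fin n) : (i : ℕ) ∈ S ↔ b i ω = 1 := by simp [hS]
      have hbS (i : Fin n) : b i ω = if (i : ℕ) ∈ S then 1 else 0 := by
        rcases h i with h0 | h1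
        · rw [if_neg, h0]; rw [hmem, h0]; exact zero_ne_one
        · rw [if_pos, h1]; rw [hmem, h1]
      simp only [Set.mem_iUnion]
      refine ⟨S, ?_, hbS⟩
      rw [hgood, mem_filter, mem_powerset]
      refine ⟨filter_subset _ _, ?_⟩
      have : (X S : ℝ) = ∑ i, b i ω * (x i : ℝ) := by
        simp only [hX]
        push_cast
        refine sum_congr rfl fun i _ => ?_
        rw [hbS i]
        split_ifs <;> simp
      rw [this]
      exact hω
    · exact Or.inl h
  have hnull : P.real {ω | ¬ ∀ i, b i ω = 0 ∨ b i ω = 1} = 0 := by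
    rw [measureReal_def, ae_iff.1 (ae_zero_or_one hp0 hp1 hb), ENNReal.toReal_zero]
  calc P.real {ω | |∑ i, b i ω * (x i : ℝ) - c| ≤ w}
      ≤ P.real {ω | ¬ ∀ i, b i ω = 0 ∨ b i ω = 1} +
          P.real (⋃ S ∈ good, {ω | ∀ i : Fin n, b i ω = if (i : ℕ) ∈ S then 1 else 0}) :=
        (measureReal_mono hsub).trans (measureReal_union_le _ _)
    _ ≤ ∑ S ∈ good, P.real {ω | ∀ i : Fin n, b i ω = if (i : ℕ) ∈ S then 1 else 0} := by
        rw [hnull, zero_add]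
        exact measureReal_biUnion_finset_le _ _
    _ = ∑ S ∈ good, p ^ #S * (1 - p) ^ (n - #S) := by
        refine sum_congr rfl fun S hS => prob_eq_indicator_eq hp0 hp1 hb ?_
        exact mem_powerset.1 (mem_filter.1 hS).1
    _ ≤ ∑ S ∈ (range n).powerset, p ^ #S * (1 - p) ^ (n - #S) *
          ∑ j ∈ range s, pointMass (t + (j : ZMod q) + ∑ i ∈ S, coordMod q x i) := by
        rw [hgood, sum_filter]
        refine sum_le_sum fun S hS => ?_
        have hw0 : 0 ≤ p ^ #S * (1 - p) ^ (n - #S) :=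
          mul_nonneg (pow_nonneg hp0 _) (pow_nonneg (by linarith) _)
        have hpm (u : ZMod q) : 0 ≤ pointMass u := by
          unfold pointMass; split_ifs <;> norm_num
        split_ifs with h
        · refine le_mul_of_one_le_right hw0 ?_
          rw [abs_le] at h
          have h1 : ⌈c - w⌉ ≤ X S := Int.ceil_le.2 (by linarith)
          have h2 : X S ≤ ⌈c - w⌉ + s - 1 := by
            have : (X S : ℝ) ≤ ((⌈c - w⌉ + s - 1 : ℤ) : ℝ) := by
              have := Int.le_ceil (c - w)
              push_cast
              linarith
            exact_mod_cast this
          have hj : ((⌈c - w⌉ + s - 1 - X S).toNat : ℤ) = ⌈c - w⌉ + s - 1 - X S :=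
            Int.toNat_of_nonneg (by omega)
          have hz : t + (((⌈c - w⌉ + s - 1 - X S).toNat : ℕ) : ZMod q) +
              ∑ i ∈ S, coordMod q x i = 0 := by
            rw [hXq S (mem_powerset.1 hS), ht,
              ← Int.cast_natCast (⌈c - w⌉ + s - 1 - X S).toNat, hj]
            push_cast
            ring
          have hmem : (⌈c - w⌉ + s - 1 - X S).toNat ∈ range s := by
            rw [mem_range]; omega
          refine le_trans ?_ (single_le_sum (fun j _ => hpm _) hmem)
          rw [hz, pointMass, if_pos rfl]
        · exact mul_nonneg hw0 (sum_nonneg fun j _ => hpm _)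
    _ = _ := by
        simp only [walk_eq_sum_powerset, mul_sum]
        rw [sum_comm]

/-- Averaging over windows of lengths `2 s` and `s` in turn gives every point of some window of
length `s` the full weight `1 / (2 s)`. -/
lemma sum_range_le_windowMean {q s : ℕ} (hs : 0 < s) {g : ZMod q → ℝ} (hg : ∀ t, 0 ≤ g t)
    (t : ZMod q) :
    ∑ j ∈ range s, g (t + (j : ZMod q)) ≤
      2 * s * windowMean s (windowMean (2 * s) g) (t - (s : ZMod q)) := by
  have hs' : (s : ℝ) ≠ 0 := by exact_mod_cast hs.ne'
  have hb (b : ℕ) (hb : b ∈ range s) : ∑ j ∈ range s, g (t + (j : ZMod q)) ≤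
      ∑ a ∈ range (2 * s), g (t - (s : ZMod q) + (b : ZMod q) + (a : ZMod q)) := by
    rw [mem_range] at hb
    have hinj : Set.InjOn (fun j : ℕ => j + (s - b)) (range s : Set ℕ) :=
      fun i _ j _ h => Nat.add_right_cancel h
    calc ∑ j ∈ range s, g (t + (j : ZMod q))
        = ∑ a ∈ (range s).image (fun j => j + (s - b)),
            g (t - (s : ZMod q) + (b : ZMod q) + (a : ZMod q)) := by
          rw [sum_image hinj]
          refine sum_congr rfl fun j _ => ?_
          rw [Nat.cast_add, Nat.cast_sub hb.le]
          congr 1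
          ring
      _ ≤ _ := by
          refine sum_le_sum_of_subset_of_nonneg (fun a ha => ?_) fun _ _ _ => hg _
          obtain ⟨j, hj, rfl⟩ := mem_image.1 ha
          rw [mem_range] at hj ⊢
          omega
  have h1 := sum_le_sum hb
  rw [sum_const, card_range, nsmul_eq_mul] at h1
  have h2 : 2 * s * windowMean s (windowMean (2 * s) g) (t - (s : ZMod q)) =
      (s : ℝ)⁻¹ * ∑ b ∈ range s, ∑ a ∈ range (2 * s),
        g (t - (s : ZMod q) + (b : ZMod q) + (a : ZMod q)) := by
    simp only [windowMean, ← mul_sum]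
    push_cast
    field_simp
  rw [h2, ← div_eq_inv_mul, le_div_iff₀ (by positivity), mul_comm]
  exact h1

lemma levyConcentration_le {Z : Ω → ℝ} {w c : ℝ}
    (h : ∀ u, P.real {ω | |Z ω - u| ≤ w} ≤ c) : levyConcentration P Z w ≤ c :=
  ciSup_le h

end Levy

/-! ### Large values of the smoothed walk -/

section Core

/-- The properties of the factors which matter for the argument, with `k` factors away
from the origin. -/
structure IsSpread (N n k : ℕ) (A : Fin n → Finset ℤ) : Prop where
  neg_mem : ∀ i, ∀ a ∈ A i, -a ∈ A i
  isTwoIntervals : ∀ i, IsTwoIntervals (A i)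
  le_card : ∀ i, 2 * N ≤ #(A i)
  abs_le : ∀ i, ∀ a ∈ A i, |a| ≤ n * N
  le_abs : ∀ i : Fin n, (i : ℕ) < k → ∀ a ∈ A i, (N : ℤ) ≤ |a|

lemma pointMass_nonneg {q : ℕ} (t : ZMod q) : 0 ≤ pointMass t := by
  unfold pointMass; split_ifs <;> norm_num

lemma pointMass_le_one {q : ℕ} (t : ZMod q) : pointMass t ≤ 1 := by
  unfold pointMass; split_ifs <;> norm_num

lemma sum_pointMass {q : ℕ} [NeZero q] : ∑ t : ZMod q, pointMass t = 1 := by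
  simp [pointMass]

variable {N n k : ℕ} {A : Fin n → Finset ℤ} {p : ℝ} {q : ℕ}

lemma IsSpread.windowMean_walk_le (hA : IsSpread N n k A) (hp0 : 0 < p) (hp : p ≤ 1 / 2)
    (hN : 0 < N) (hkn : k ≤ n) (hq : 4 * n ^ 2 * N ≤ q) {x : Fin n → ℤ}
    (hx : ∀ i, x i ∈ A i) {l : ℕ} (hl : k ≤ l) (hn : 0 < n) (t : ZMod q) :
    windowMean N (walk p (coordMod q x) pointMass l) t ≤
      (N : ℝ)⁻¹ * (1 / √(2 * p * (k + 1))) := by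
  obtain ⟨m, rfl⟩ := Nat.exists_eq_add_of_le hl
  rw [walk_add, ← walk_windowMean]
  refine walk_le hp0.le (by linarith) (fun t => ?_) m t
  set X : ℕ → ℤ := fun i => if h : i < n then x ⟨i, h⟩ else 0 with hX
  have hXabs (i : ℕ) (hi : i < k) : |X i| ≤ n * N := by
    have hin : i < n := hi.trans_le hkn
    simp only [hX, dif_pos hin]
    exact hA.abs_le _ _ (hx _)
  refine windowMean_walk_pointMass_le (x := X) (D := n * (n * N)) hp0 hp hN (fun i hi => ?_) ?_ ?_ _
    (fun i hi => ?_) t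
  · have hin : i < n := hi.trans_le hkn
    simp only [hX, dif_pos hin]
    exact hA.le_abs _ hi _ (hx _)
  · calc ∑ i ∈ range k, |X i| ≤ ∑ i ∈ range k, (n * N : ℤ) :=
          sum_le_sum fun i hi => hXabs i (mem_range.1 hi)
      _ = k * (n * N) := by simp
      _ ≤ n * (n * N) := by gcongr
  · have h1 : 1 * N ≤ n ^ 2 * N := Nat.mul_le_mul_right _ (Nat.one_le_pow _ _ hn)
    have h2 : 2 * (n * (n * N)) + N ≤ q := by nlinarith
    exact_mod_cast h2
  · have hin : i < n := hi.trans_le hkn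
    simp only [hX, dif_pos hin, coordMod]

lemma injOn_intCast_of_abs_le {M : ℕ} (hq : 2 * M < q) {S : Finset ℤ} (hS : ∀ a ∈ S, |a| ≤ M) :
    Set.InjOn (fun a : ℤ => (a : ZMod q)) S := by
  intro a ha a' ha' h
  have h1 : ((a - a' : ℤ) : ZMod q) = 0 := by
    push_cast; exact sub_eq_zero.2 h
  have h2 := abs_le.1 (hS a ha)
  have h3 := abs_le.1 (hS a' ha')
  have := Int.eq_zero_of_abs_lt_dvd ((ZMod.intCast_zmod_eq_zero_iff_dvd _ q).1 h1)
    (by rw [abs_lt]; constructor <;> omega)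
  omega

/-- The coordinates of an integer vector, continued by zero. -/
def coordInt (x : Fin n → ℤ) (i : ℕ) : ℤ := if h : i < n then x ⟨i, h⟩ else 0

lemma coordMod_eq_coordInt (x : Fin n → ℤ) {i : ℕ} : coordMod q x i = (coordInt x i : ZMod q) := by
  unfold coordMod coordInt
  split_ifs <;> simp

open Classical in
/-- The set of vectors for which some frequency between `α₀` and `α₁` is resonant: at least
`s` coordinates in `C` multiply it to a point within `r` of an integer. -/
noncomputable def resonantVectors (q : ℕ) (A : Fin n → Finset ℤ) (C : Finset (Fin n))
    (α₀ α₁ r : ℝ) (s : ℕ) : Finset (Fin n → ℤ) :=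
  {x ∈ Fintype.piFinset A | ∃ j : ZMod q, α₀ ≤ frequency j ∧ frequency j ≤ α₁ ∧
    s ≤ #{i ∈ C | NearInt (frequency j) r (x i)}}

open Classical in
lemma mem_resonantVectors {C : Finset (Fin n)} {α₀ α₁ r : ℝ} {s : ℕ}
    {x : Fin n → ℤ} : x ∈ resonantVectors q A C α₀ α₁ r s ↔ x ∈ Fintype.piFinset A ∧
      ∃ j : ZMod q, α₀ ≤ frequency j ∧ frequency j ≤ α₁ ∧
        s ≤ #{i ∈ C | NearInt (frequency j) r (x i)} := by
  simp [resonantVectors]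

variable [NeZero q]

/-- Chebyshev's inequality on a translate of `S`: the points where `f` exceeds `lam` are among those
where `e` exceeds `c`. -/
lemma card_lt_le_of_sum_sq_le {e f : ZMod q → ℝ} {c η lam : ℝ} (hc : 0 < c)
    (hf : ∀ t, lam < f t → c < e t) (he : ∑ t, e t ^ 2 ≤ η) {S : Finset ℤ}
    (hS : Set.InjOn (fun a : ℤ => (a : ZMod q)) S) (t : ZMod q) :
    (#{a ∈ S | lam < f (t + ((a : ℤ) : ZMod q))} : ℝ) ≤ η / c ^ 2 := by
  rw [le_div_iff₀ (by positivity), ← nsmul_eq_mul]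
  refine le_trans ?_ he
  have hinj : Set.InjOn (fun a : ℤ => t + (a : ZMod q))
      ({a ∈ S | lam < f (t + ((a : ℤ) : ZMod q))} : Finset ℤ) := fun a ha a' ha' h =>
    hS (mem_filter.1 ha).1 (mem_filter.1 ha').1 (add_left_cancel h)
  calc #{a ∈ S | lam < f (t + ((a : ℤ) : ZMod q))} • c ^ 2
      ≤ ∑ a ∈ S with lam < f (t + ((a : ℤ) : ZMod q)), e (t + ((a : ℤ) : ZMod q)) ^ 2 := by
        refine card_nsmul_le_sum _ _ _ fun a ha => ?_
        have := hf _ (mem_filter.1 ha).2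
        gcongr
    _ = ∑ u ∈ ({a ∈ S | lam < f (t + ((a : ℤ) : ZMod q))}).image
          fun a : ℤ => t + (a : ZMod q), e u ^ 2 :=
        (sum_image (f := fun u => e u ^ 2) hinj).symm
    _ ≤ ∑ u, e u ^ 2 :=
        sum_le_sum_of_subset_of_nonneg (subset_univ _) fun _ _ _ => sq_nonneg _

lemma IsSpread.card_resonantVectors_le (hA : IsSpread N n k A) (hN : 0 < N) (C : Finset (Fin n))
    {α₀ α₁ r τ : ℝ} (hα₀ : 0 < α₀) (hr : 0 < r) (hr2 : r ≤ 1 / 2) (hτ0 : 0 < τ) (hτ1 : τ ≤ 1)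
    (hτ : 2 * (2 * r + α₁ + 2 * r / (α₀ * N) + 1 / N) ≤ τ) (s : ℕ) :
    (#(resonantVectors q A C α₀ α₁ r s) : ℝ) ≤
      q * (2 ^ #C * τ ^ s * #(Fintype.piFinset A)) := by
  classical
  have hN' : (0 : ℝ) < N := by exact_mod_cast hN
  have hsub : resonantVectors q A C α₀ α₁ r s ⊆
      ({j : ZMod q | α₀ ≤ frequency j ∧ frequency j ≤ α₁} : Finset (ZMod q)).biUnion fun j =>
        {x ∈ Fintype.piFinset A | s ≤ #{i ∈ C | NearInt (frequency j) r (x i)}} := by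
    intro x hx
    obtain ⟨hx, j, h0, h1, hs⟩ := mem_resonantVectors.1 hx
    rw [mem_biUnion]
    exact ⟨j, mem_filter.2 ⟨mem_univ _, h0, h1⟩, mem_filter.2 ⟨hx, hs⟩⟩
  have h1 : (#(resonantVectors q A C α₀ α₁ r s) : ℝ) ≤
      ∑ j ∈ ({j : ZMod q | α₀ ≤ frequency j ∧ frequency j ≤ α₁} : Finset (ZMod q)),
        (#{x ∈ Fintype.piFinset A | s ≤ #{i ∈ C | NearInt (frequency j) r (x i)}} : ℝ) := by
    exact_mod_cast (card_le_card hsub).trans card_biUnion_le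
  refine h1.trans ?_
  have h2 : ∀ j ∈ ({j : ZMod q | α₀ ≤ frequency j ∧ frequency j ≤ α₁} : Finset (ZMod q)),
      (#{x ∈ Fintype.piFinset A | s ≤ #{i ∈ C | NearInt (frequency j) r (x i)}} : ℝ) ≤
        2 ^ #C * τ ^ s * #(Fintype.piFinset A) := by
    intro j hj
    obtain ⟨-, hj0, hj1⟩ := mem_filter.1 hj
    have hα : 0 < frequency j := hα₀.trans_le hj0
    refine card_many_le C _ hτ0 hτ1 (fun i _ => ?_) s
    refine (card_nearInt_le hα hr hr2 (hA.isTwoIntervals i) hN (hA.le_card i)).trans ?_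
    gcongr
    refine le_trans ?_ hτ
    have h3 : 2 * (frequency j + 1 / N) * (2 * r / frequency j + 1) =
        2 * (2 * r + frequency j + 2 * r / (frequency j * N) + 1 / N) := by
      field_simp
      ring
    rw [h3]
    gcongr
  refine (sum_le_sum h2).trans ?_
  rw [sum_const, nsmul_eq_mul]
  gcongr
  calc #({j : ZMod q | α₀ ≤ frequency j ∧ frequency j ≤ α₁} : Finset (ZMod q))
      ≤ #(univ : Finset (ZMod q)) := card_le_card (subset_univ _)
    _ = q := by rw [card_univ, ZMod.card]

/-- The coordinates from `n - 2 k` up to `n - k - 1`. -/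
def middleCoords (n k : ℕ) : Finset (Fin n) :=
  univ.filter fun i : Fin n => n - 2 * k ≤ (i : ℕ) ∧ (i : ℕ) < n - k

lemma card_range_filter_le (h2k : 2 * k ≤ n) (x : Fin n → ℤ) (Q : ℤ → Prop) [DecidablePred Q] :
    #{i ∈ range k | Q (coordInt x (n - 2 * k + i))} ≤ #{i ∈ middleCoords n k | Q (x i)} := by
  classical
  refine (card_le_card fun i hi => ?_).trans
    (card_image_le (s := {i ∈ middleCoords n k | Q (x i)}) (f := fun i => (i : ℕ) - (n - 2 * k)))
  obtain ⟨hi, hQ⟩ := mem_filter.1 hi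
  rw [mem_range] at hi
  have hin : n - 2 * k + i < n := by omega
  rw [coordInt, dif_pos hin] at hQ
  refine mem_image.2 ⟨⟨n - 2 * k + i, hin⟩, mem_filter.2 ⟨mem_filter.2 ⟨mem_univ _, ?_⟩, hQ⟩, ?_⟩
  · exact ⟨by simp, by simp; omega⟩
  · simp

/-- Outside a set of exponentially small probability, the smoothed walk after all `n` steps
is at most `4 c / p`. The steps from `k` to `n - 2 k` bring its maximum down to `H`, the next `k`
steps make it close to its means at scale `N` for most points, and the last `k` steps then remove
the exceptional points. -/
theorem IsSpread.card_exists_lt_le (hA : IsSpread N n k A) (hp0 : 0 < p) (hp : p ≤ 1 / 2)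
    (hN : 0 < N) (hn : 0 < n) (hk : 4 * k ≤ n) (hq : 4 * n ^ 2 * N ≤ q) {s : ℕ} (hs : 0 < s)
    {c : ℝ} (hc : c = (N : ℝ)⁻¹ * (1 / √(2 * p * (k + 1))))
    {H ε τ κ r α₀ α₁ : ℝ} (hH : 0 < H) (hε : 0 < ε) (hεp : ε ≤ p) (hτ0 : 0 < τ) (hτ1 : τ ≤ 1)
    (hα₀ : 0 < α₀) (hα₁ : 0 < α₁) (hr : 0 < r) (hr2 : r ≤ 1 / 2)
    (hdecay : (1 - p + ε) ^ (n - 4 * k) ≤ H) (hτH : 3 * c / (ε * H) ≤ τ)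
    (hτr : 2 * (2 * r + α₁ + 2 * r / (α₀ * N) + 1 / N) ≤ τ)
    (hlow : 2 * Real.pi * N * α₀ ≤ κ) (hhigh : 1 / (s * α₁) ≤ κ)
    (hmid : 2 * Real.exp (-(4 * p * r ^ 2)) ^ (k - k / 2) ≤ κ)
    (hτκ : κ ^ 2 * H / (2 * N * c ^ 2) ≤ τ)
    (hdecay' : (1 - p / 2) ^ (k - k / 2) * H ≤ 4 * c / p) :
    (#{x ∈ Fintype.piFinset A | ∃ t : ZMod q, 4 * c / p <
        windowMean s (windowMean (2 * s) (walk p (coordMod q x) pointMass n)) t} : ℝ) ≤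
      3 * (4 ^ n * q * τ ^ (k / 2)) * #(Fintype.piFinset A) := by
  classical
  have hp1 : p ≤ 1 := by linarith
  have hN' : (0 : ℝ) < N := by exact_mod_cast hN
  have hc0 : 0 < c := by rw [hc]; positivity
  have h2s : 0 < 2 * s := by omega
  set 𝒜 := Fintype.piFinset A with h𝒜
  have hmem {x : Fin n → ℤ} (hx : x ∈ 𝒜) : ∀ i, x i ∈ A i := Fintype.mem_piFinset.1 hx
  have hupd {x : Fin n → ℤ} (hx : x ∈ 𝒜) (i : Fin n) (a : ℤ) (ha : a ∈ A i) :
      Function.update x i a ∈ 𝒜 := by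
    refine Fintype.mem_piFinset.2 fun j => ?_
    by_cases hj : j = i
    · subst hj; simpa using ha
    · rw [Function.update_of_ne hj]; exact hmem hx j
  -- `g` is the walk started from a uniform distribution on `2 s` points, and `f` its smoothing.
  set F : ZMod q → ℝ := windowMean (2 * s) pointMass with hF
  have hF0 (t) : 0 ≤ F t := windowMean_nonneg _ pointMass_nonneg t
  have hF1 (t) : F t ≤ 1 := windowMean_le h2s pointMass_le_one t
  have hFsum : ∑ t, F t = 1 := by rw [hF, sum_windowMean h2s, sum_pointMass]
  set g : (Fin n → ℤ) → ℕ → ZMod q → ℝ := fun x l => walk p (coordMod q x) F l with hg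
  have hg0 (x l t) : 0 ≤ g x l t := walk_nonneg hp0.le hp1 hF0 l t
  have hgN (x) (hx : x ∈ 𝒜) (l) (hl : k ≤ l) (t) : windowMean N (g x l) t ≤ c := by
    simp only [hg, hF]
    rw [walk_windowMean, windowMean_comm]
    refine windowMean_le h2s (fun t => ?_) t
    rw [hc]
    exact hA.windowMean_walk_le hp0 hp hN (by omega) hq (hmem hx) hl hn t
  set Fs : ZMod q → ℝ := windowMean s F with hFs
  set f : (Fin n → ℤ) → ℕ → ZMod q → ℝ := fun x l => walk p (coordMod q x) Fs l with hf
  have hfg (x l) : f x l = windowMean s (g x l) := walk_windowMean s l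
  have hfN (x) (hx : x ∈ 𝒜) (l) (hl : k ≤ l) (t) : windowMean N (f x l) t ≤ c := by
    rw [hfg, windowMean_comm]
    exact windowMean_le hs (hgN x hx l hl) t
  -- the three exceptional sets
  set bad₁ : Finset (Fin n → ℤ) := {x ∈ 𝒜 | ∃ t, H < g x (k + (n - 3 * k)) t} with hbad₁
  set bad₂ := resonantVectors q A (middleCoords n k) α₀ α₁ r (k / 2) with hbad₂
  set E : Finset (Fin n → ℤ) := {x ∈ 𝒜 | x ∉ bad₁ ∧ x ∉ bad₂} with hE
  set bad₃ : Finset (Fin n → ℤ) := {x ∈ E | ∃ t, 4 * c / p < f x (n - k + k) t} with hbad₃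
  have hpow {m : ℕ} (hm : k / 2 ≤ m) : τ ^ m ≤ τ ^ (k / 2) := pow_le_pow_of_le_one hτ0.le hτ1 hm
  have hbad₁_le : (#bad₁ : ℝ) ≤ 4 ^ n * q * τ ^ (k / 2) * #𝒜 := by
    have h := card_exists_lt_walk_le (n := n) (A := A) (E := 𝒜) (q := q) (p := p) (τ := τ)
      (lam := ε * H) (H := H) (B := 1) (l₀ := k) (m := n - 3 * k) (s := k) F hp0.le hp hτ0 hτ1
      (by positivity) hH zero_le_one (by omega) (fun x hx => hmem hx)
      (fun x hx i _ a ha => hupd hx i a ha) hA.neg_mem (fun x _ t => walk_le hp0.le hp1 hF1 k t)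
      (fun x hx i hi t => ?_) ?_ ?_
    · refine h.trans ?_
      gcongr ?_ * _ * ?_ * _
      · exact pow_le_pow_right₀ (by norm_num) (by omega)
      · exact hpow (Nat.div_le_self _ _)
    · refine (card_lt_le_of_windowMean_le hN (hg0 x i) (hgN x hx i hi) (hA.isTwoIntervals i)
        (hA.le_card i) (by positivity) t).trans ?_
      gcongr
    · rw [mul_div_cancel_right₀ _ hH.ne']; linarith
    · rw [mul_div_cancel_right₀ _ hH.ne', mul_one, show n - 3 * k - k = n - 4 * k by omega]
      exact hdecay
  have hbad₂_le : (#bad₂ : ℝ) ≤ 4 ^ n * q * τ ^ (k / 2) * #𝒜 := by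
    refine (hA.card_resonantVectors_le hN (middleCoords n k) hα₀ hr hr2 hτ0 hτ1 hτr (k / 2)).trans ?_
    have h1 : (2 : ℝ) ^ #(middleCoords n k) ≤ 4 ^ n := by
      calc (2 : ℝ) ^ #(middleCoords n k) ≤ 2 ^ n :=
            pow_le_pow_right₀ (by norm_num) (by simpa using card_le_univ (middleCoords n k))
        _ ≤ 4 ^ n := by gcongr; norm_num
    calc (q : ℝ) * (2 ^ #(middleCoords n k) * τ ^ (k / 2) * #𝒜)
        ≤ q * (4 ^ n * τ ^ (k / 2) * #𝒜) := by gcongr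
      _ = _ := by ring
  have hgE (x) (hx : x ∈ E) (t) : g x (n - 2 * k) t ≤ H := by
    obtain ⟨hx, h1, -⟩ := mem_filter.1 hx
    rw [show n - 2 * k = k + (n - 3 * k) by omega]
    by_contra! h
    exact h1 (mem_filter.2 ⟨hx, t, h⟩)
  have hfE (x) (hx : x ∈ E) (t) : f x (n - k) t ≤ H := by
    rw [hfg]
    refine windowMean_le hs (fun t => ?_) t
    simp only [hg]
    rw [show n - k = (n - 2 * k) + k by omega, walk_add]
    exact walk_le hp0.le hp1 (hgE x hx) k t
  -- `e` is the deviation of `f` from its means at scale `N`.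
  have heE (x) (hx : x ∈ E) (l) (hl : n - k ≤ l) :
      ∑ t, (f x l t - windowMean N (f x l) t) ^ 2 ≤ κ ^ 2 * H := by
    obtain ⟨m, rfl⟩ := Nat.exists_eq_add_of_le hl
    have h1 : (fun t => f x (n - k + m) t - windowMean N (f x (n - k + m)) t) =
        walk p (fun i => coordMod q x (n - k + i))
          (fun t => f x (n - k) t - windowMean N (f x (n - k)) t) m := by
      rw [walk_sub, walk_windowMean]
      simp only [hf]
      rw [walk_add]
    have h2 : ∑ t, (f x (n - k + m) t - windowMean N (f x (n - k + m)) t) ^ 2 ≤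
        ∑ t, (f x (n - k) t - windowMean N (f x (n - k)) t) ^ 2 := by
      have := sum_walk_sq_le (y := fun i => coordMod q x (n - k + i))
        (F := fun t => f x (n - k) t - windowMean N (f x (n - k)) t) hp0.le hp1 m
      rw [← h1] at this
      exact this
    refine h2.trans ?_
    have h3 : f x (n - k) = windowMean s
        (walk p (fun i => coordMod q x (n - 2 * k + i)) (g x (n - 2 * k)) k) := by
      rw [hfg]
      simp only [hg]
      rw [← walk_add, show n - 2 * k + k = n - k by omega]
    rw [h3]
    refine (sum_sq_sub_windowMean_le hp0.le hp1 hs hN hα₁ hlow hhigh _ (fun j hj0 hj1 => ?_) _).trans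
      ?_
    · refine le_trans ?_ hmid
      refine mul_le_mul_of_nonneg_left ?_ two_pos.le
      refine prod_norm_bernoulli_le (x := fun i => coordInt x (n - 2 * k + i)) hp0.le hp hr.le
        (fun i _ => coordMod_eq_coordInt x) ?_
      obtain ⟨hx, -, h2⟩ := mem_filter.1 hx
      have h4 : #{i ∈ middleCoords n k | NearInt (frequency j) r (x i)} < k / 2 := by
        by_contra! h
        exact h2 (mem_resonantVectors.2 ⟨hx, j, hj0, hj1, h⟩)
      have h5 := card_range_filter_le (k := k) (by omega) x (NearInt (frequency j) r)
      omega
    · gcongr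
      calc ∑ t, g x (n - 2 * k) t ^ 2 ≤ ∑ t, H * g x (n - 2 * k) t := by
            refine sum_le_sum fun t _ => ?_
            rw [pow_two]
            exact mul_le_mul_of_nonneg_right (hgE x hx t) (hg0 _ _ _)
        _ = H := by
            rw [← mul_sum]
            simp only [hg]
            rw [sum_walk, hFsum, mul_one]
  have hbad₃_le : (#bad₃ : ℝ) ≤ 4 ^ n * q * τ ^ (k / 2) * #𝒜 := by
    have hEE : E ⊆ 𝒜 := filter_subset _ _
    have hratio : 2 * c / (4 * c / p) = p / 2 := by field_simp; norm_num
    have h := card_exists_lt_walk_le (n := n) (A := A) (E := E) (q := q) (p := p) (τ := τ)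
      (lam := 2 * c) (H := 4 * c / p) (B := H) (l₀ := n - k) (m := k) (s := k / 2) Fs hp0.le hp
      hτ0 hτ1 (by positivity) (by positivity) hH.le (by omega) (fun x hx => hmem (hEE hx))
      (fun x hx i hi a ha => ?_) hA.neg_mem hfE (fun x hx i hi t => ?_) ?_ ?_
    · refine h.trans ?_
      gcongr ?_ * _ * _ * ?_
      · exact pow_le_pow_right₀ (by norm_num) (by omega)
      · exact_mod_cast card_le_card hEE
    · obtain ⟨hx, h1, h2⟩ := mem_filter.1 hx
      refine mem_filter.2 ⟨hupd hx i a ha, fun h => h1 ?_, fun h => h2 ?_⟩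
      · obtain ⟨-, t, ht⟩ := mem_filter.1 h
        refine mem_filter.2 ⟨hx, t, ?_⟩
        simp only [hg] at ht ⊢
        rwa [walk_coordMod_update p F x i a (by omega)] at ht
      · obtain ⟨-, j, h0, h1, hs⟩ := mem_resonantVectors.1 h
        refine mem_resonantVectors.2 ⟨hx, j, h0, h1, hs.trans (card_le_card fun i' hi' => ?_)⟩
        obtain ⟨hmid', hQ⟩ := mem_filter.1 hi'
        have hne : i' ≠ i := by
          rintro rfl
          have h3 : (i' : ℕ) < n - k := (mem_filter.1 hmid').2.2
          omega
        rw [Function.update_of_ne hne] at hQ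
        exact mem_filter.2 ⟨hmid', hQ⟩
    · have h1 : (2 * N : ℝ) ≤ #(A i) := by exact_mod_cast hA.le_card i
      have h2 : (#{a ∈ A i | 2 * c < f x i (t + ((a : ℤ) : ZMod q))} : ℝ) ≤
          κ ^ 2 * H / c ^ 2 := by
        refine card_lt_le_of_sum_sq_le hc0 (fun t ht => ?_) (heE x hx i hi)
          (injOn_intCast_of_abs_le (M := n * N) ?_ fun a ha => by exact_mod_cast hA.abs_le i a ha) t
        · have := hfN x (hEE hx) i (by omega) t
          linarith
        · have : 1 * (n * N) ≤ n * (n * N) := Nat.mul_le_mul_right _ hn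
          have : 0 < n * N := Nat.mul_pos hn hN
          nlinarith
      refine h2.trans ?_
      have h3 : κ ^ 2 * H / c ^ 2 = κ ^ 2 * H / (2 * N * c ^ 2) * (2 * N) := by
        field_simp
      rw [h3]
      gcongr
    · rw [hratio]; linarith
    · rw [hratio, show 1 - p + p / 2 = 1 - p / 2 by ring]
      exact hdecay'
  have hsub : {x ∈ 𝒜 | ∃ t : ZMod q, 4 * c / p <
      windowMean s (windowMean (2 * s) (walk p (coordMod q x) pointMass n)) t} ⊆
      bad₁ ∪ bad₂ ∪ bad₃ := by
    intro x hx
    obtain ⟨hx, t, ht⟩ := mem_filter.1 hx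
    by_cases h1 : x ∈ bad₁
    · exact mem_union_left _ (mem_union_left _ h1)
    by_cases h2 : x ∈ bad₂
    · exact mem_union_left _ (mem_union_right _ h2)
    refine mem_union_right _ (mem_filter.2 ⟨mem_filter.2 ⟨hx, h1, h2⟩, t, ?_⟩)
    rw [Nat.sub_add_cancel (by omega), hfg]
    simp only [hg, hF]
    rwa [walk_windowMean]
  have hcard : (#{x ∈ 𝒜 | ∃ t : ZMod q, 4 * c / p <
      windowMean s (windowMean (2 * s) (walk p (coordMod q x) pointMass n)) t} : ℝ) ≤
      #bad₁ + #bad₂ + #bad₃ := by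
    exact_mod_cast (card_le_card hsub).trans
      ((card_union_le _ _).trans (Nat.add_le_add_right (card_union_le _ _) _))
  linarith

end Core

/-! ### Choice of the parameters -/

section Parameters

variable {N n k : ℕ} {A : Fin n → Finset ℤ} {p β z : ℝ}

/-- Two-sided bounds for the Littlewood–Offord constant after `k = ⌊β n⌋` steps. -/
lemma littlewoodOfford_const_bounds (hp0 : 0 < p) (hp : p ≤ 1 / 2) (hβ : 0 < β) (hN : 0 < N)
    (hz : 0 < z) (hzn : z ^ 16 = n) (hk : k = ⌊β * n⌋₊) (hkn : k + 1 ≤ n) :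
    1 / (N * z ^ 8) ≤ (N : ℝ)⁻¹ * (1 / √(2 * p * (k + 1))) ∧
      (N : ℝ)⁻¹ * (1 / √(2 * p * (k + 1))) ≤ 1 / √(2 * p * β) * (1 / (N * z ^ 8)) := by
  have hN' : (0 : ℝ) < N := by exact_mod_cast hN
  have hkn' : (k : ℝ) + 1 ≤ n := by exact_mod_cast hkn
  have hk1 : β * n ≤ k + 1 := by rw [hk]; exact (Nat.lt_floor_add_one _).le
  have hz8 : z ^ 8 = √(n : ℝ) := by
    rw [← hzn, show z ^ 16 = (z ^ 8) ^ 2 by ring, Real.sqrt_sq (by positivity)]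
  have h1 : √(2 * p * (k + 1)) ≤ z ^ 8 := by
    rw [hz8]
    refine Real.sqrt_le_sqrt ?_
    have : (0 : ℝ) ≤ (k : ℝ) + 1 := by positivity
    nlinarith
  have h2 : √(2 * p * β) * z ^ 8 ≤ √(2 * p * (k + 1)) := by
    rw [hz8, ← Real.sqrt_mul (by positivity)]
    refine Real.sqrt_le_sqrt ?_
    nlinarith
  have h3 : 0 < √(2 * p * β) := Real.sqrt_pos.2 (by positivity)
  have h4 : 0 < √(2 * p * (k + 1)) := Real.sqrt_pos.2 (by positivity)
  constructor
  · rw [one_div, mul_inv, one_div]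
    gcongr
  · calc (N : ℝ)⁻¹ * (1 / √(2 * p * (k + 1))) ≤ (N : ℝ)⁻¹ * (1 / (√(2 * p * β) * z ^ 8)) := by
          gcongr
      _ = _ := by field_simp

/-- The parameters of `IsSpread.card_exists_lt_le` as powers of `z = n ^ (1 / 16)`, in the case
`N ≥ √n`. -/
theorem IsSpread.card_exists_lt_le_of_pow (hA : IsSpread N n k A) (hp0 : 0 < p) (hp : p ≤ 1 / 2)
    (hβ : 0 < β) (hβ4 : β ≤ 1 / 4) (hzn : z ^ 16 = n) (hz2 : 2 ≤ z) (hzN : z ^ 8 ≤ N)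
    (hk : k = ⌊β * n⌋₊) (hβn : 6 ≤ β * n) {q : ℕ} [NeZero q] (hq : 4 * n ^ 2 * N ≤ q) {s : ℕ}
    (hs : z ^ 8 ≤ s) {c : ℝ} (hc : c = (N : ℝ)⁻¹ * (1 / √(2 * p * (k + 1)))) {R ε τ : ℝ}
    (hε : 0 < ε) (hεp : ε ≤ p) (hτ0 : 0 < τ) (hτ1 : τ ≤ 1)
    (hdecay : (1 - p + ε) ^ (n - 4 * k) ≤ R / (N * z ^ 8)) (hR1 : 1 ≤ R)
    (hR : 3 * (1 / √(2 * p * β)) / (ε * τ) ≤ R) (hτz : 12 ≤ τ * z)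
    (hpβz : 6 ≤ (p * β) ^ 4 * z ^ 2) (hRz : 32 * R ≤ τ * z ^ 4)
    (hRn : R * Real.exp (-(p * β / 8 * n)) ≤ 1) :
    (#{x ∈ Fintype.piFinset A | ∃ t : ZMod q, 4 * c / p <
        windowMean s (windowMean (2 * s) (walk p (coordMod q x) pointMass n)) t} : ℝ) ≤
      3 * (4 ^ n * q * τ ^ (k / 2)) * #(Fintype.piFinset A) := by
  have hz0 : 0 < z := by linarith
  have hz1 : 1 ≤ z := by linarith
  have hN' : (0 : ℝ) < N := lt_of_lt_of_le (by positivity) hzN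
  have hN : 0 < N := by exact_mod_cast hN'
  have hs' : (0 : ℝ) < s := lt_of_lt_of_le (by positivity) hs
  have hs0 : 0 < s := by exact_mod_cast hs'
  have hn' : (0 : ℝ) < n := by rw [← hzn]; positivity
  have hn : 0 < n := by exact_mod_cast hn'
  have hkβ : (k : ℝ) ≤ β * n := by rw [hk]; exact Nat.floor_le (by positivity)
  have hkβ' : β * n ≤ k + 1 := by rw [hk]; exact (Nat.lt_floor_add_one _).le
  have h4k : 4 * k ≤ n := by
    have : (4 * k : ℝ) ≤ n := by nlinarith
    exact_mod_cast this
  have hkn : k + 1 ≤ n := by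
    have : 6 ≤ (n : ℝ) := by nlinarith
    have : 6 ≤ n := by exact_mod_cast this
    omega
  have hhalf : β * n / 4 ≤ ((k - k / 2 : ℕ) : ℝ) := by
    have h1 : k ≤ 2 * (k - k / 2) := by omega
    have h2 : (k : ℝ) ≤ 2 * ((k - k / 2 : ℕ) : ℝ) := by exact_mod_cast h1
    linarith
  obtain ⟨hc1, hc2⟩ := littlewoodOfford_const_bounds hp0 hp hβ hN hz0 hzn hk hkn
  rw [← hc] at hc1 hc2
  have hc0 : 0 < c := lt_of_lt_of_le (by positivity) hc1
  have hpβ : 0 < p * β := by positivity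
  have hR0 : 0 < R := by linarith
  refine hA.card_exists_lt_le (H := R / (N * z ^ 8)) (ε := ε) (κ := 8 * (z ^ 6)⁻¹)
    (r := (z ^ 7)⁻¹) (α₀ := (z ^ 6)⁻¹ / N) (α₁ := (z ^ 2)⁻¹) hp0 hp hN hn h4k hq hs0 hc
    (by positivity) hε hεp hτ0 hτ1 (by positivity) (by positivity) (by positivity) ?_ hdecay ?_ ?_
    ?_ ?_ ?_ ?_ ?_
  · rw [one_div]
    gcongr
    calc (2 : ℝ) ≤ z := hz2
      _ ≤ z ^ 7 := le_self_pow₀ hz1 (by norm_num)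
  · rw [div_le_iff₀ (by positivity)]
    rw [div_le_iff₀ (by positivity)] at hR
    calc 3 * c ≤ 3 * (1 / √(2 * p * β)) * (1 / (N * z ^ 8)) := by linarith
      _ ≤ R * (ε * τ) * (1 / (N * z ^ 8)) := by gcongr
      _ = _ := by ring
  · have h1 : 2 * (z ^ 7)⁻¹ / ((z ^ 6)⁻¹ / N * N) = 2 * z⁻¹ := by field_simp
    have h2 : (1 : ℝ) / N ≤ z⁻¹ := by
      rw [one_div]
      gcongr
      exact (le_self_pow₀ hz1 (by norm_num)).trans hzN
    have h3 : (z ^ 7)⁻¹ ≤ z⁻¹ := by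
      gcongr; exact le_self_pow₀ hz1 (by norm_num)
    have h4 : (z ^ 2)⁻¹ ≤ z⁻¹ := by
      gcongr; exact le_self_pow₀ hz1 (by norm_num)
    have h5 : 12 * z⁻¹ ≤ τ := by
      rw [← div_eq_mul_inv, div_le_iff₀ hz0]; exact hτz
    rw [h1]
    linarith
  · have h1 : 2 * Real.pi * N * ((z ^ 6)⁻¹ / N) = 2 * Real.pi * (z ^ 6)⁻¹ := by field_simp
    rw [h1]
    gcongr
    linarith [Real.pi_le_four]
  · rw [div_le_iff₀ (by positivity)]
    calc (1 : ℝ) = (z ^ 6)⁻¹ * (z ^ 8 * (z ^ 2)⁻¹) := by field_simp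
      _ ≤ 8 * (z ^ 6)⁻¹ * (s * (z ^ 2)⁻¹) := by
        gcongr
        have : 0 < (z ^ 6)⁻¹ := by positivity
        linarith
  · have h1 : Real.exp (-(4 * p * ((z ^ 7)⁻¹) ^ 2)) ^ (k - k / 2) ≤
        Real.exp (-(p * β * z ^ 2)) := by
      rw [← Real.exp_nat_mul]
      refine Real.exp_le_exp.2 ?_
      have h2 : p * β * z ^ 2 = (β * n / 4) * (4 * p * ((z ^ 7)⁻¹) ^ 2) := by
        rw [← hzn]; field_simp
      have h3 : (β * n / 4) * (4 * p * ((z ^ 7)⁻¹) ^ 2) ≤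
          ((k - k / 2 : ℕ) : ℝ) * (4 * p * ((z ^ 7)⁻¹) ^ 2) := by gcongr
      linarith
    have h4 : z ^ 6 / 4 ≤ Real.exp (p * β * z ^ 2) := by
      refine le_trans ?_ (Real.pow_div_factorial_le_exp (p * β * z ^ 2) (by positivity) 4)
      have h5 : (p * β * z ^ 2) ^ 4 = (p * β) ^ 4 * z ^ 2 * z ^ 6 := by ring
      rw [h5]
      have h6 : 6 * z ^ 6 ≤ (p * β) ^ 4 * z ^ 2 * z ^ 6 := by gcongr
      norm_num [Nat.factorial]
      linarith
    have h7 : Real.exp (-(p * β * z ^ 2)) ≤ 4 * (z ^ 6)⁻¹ := by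
      rw [Real.exp_neg, ← div_eq_mul_inv, ← inv_div]
      gcongr
    linarith
  · rw [div_le_iff₀ (by positivity)]
    have h1 : 1 / (N * z ^ 8) ^ 2 ≤ c ^ 2 := by
      rw [← one_div_pow]; gcongr
    have h2 : (8 * (z ^ 6)⁻¹) ^ 2 * (R / (N * z ^ 8)) =
        32 * R * (z ^ 4)⁻¹ * (2 * N * (1 / (N * z ^ 8) ^ 2)) := by field_simp; norm_num
    have h3 : 32 * R * (z ^ 4)⁻¹ ≤ τ := by
      rw [← div_eq_mul_inv, div_le_iff₀ (by positivity)]; exact hRz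
    rw [h2]
    gcongr
  · have h1 : (1 - p / 2) ^ (k - k / 2) ≤ Real.exp (-(p * β / 8 * n)) := by
      calc (1 - p / 2) ^ (k - k / 2) ≤ Real.exp (-(p / 2)) ^ (k - k / 2) := by
            refine pow_le_pow_left₀ (by linarith) ?_ _
            have := Real.add_one_le_exp (-(p / 2))
            linarith
        _ = Real.exp (((k - k / 2 : ℕ) : ℝ) * -(p / 2)) := (Real.exp_nat_mul _ _).symm
        _ ≤ _ := Real.exp_le_exp.2 (by nlinarith)
    calc (1 - p / 2) ^ (k - k / 2) * (R / (N * z ^ 8))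
        ≤ Real.exp (-(p * β / 8 * n)) * (R / (N * z ^ 8)) := by gcongr
      _ = R * Real.exp (-(p * β / 8 * n)) * (1 / (N * z ^ 8)) := by ring
      _ ≤ 1 * (1 / (N * z ^ 8)) := by gcongr
      _ ≤ c := by rw [one_mul]; exact hc1
      _ ≤ 4 * c / p := by rw [le_div_iff₀ hp0]; nlinarith

/-- The exceptional probability `τ` for which the bound of `IsSpread.card_exists_lt_le` with
`q = 4 n² N` beats `e ^ (-M n)`; here `3 * 4 ^ n * q ≤ 384 ^ n ≤ e ^ (7 n)`. -/
lemma three_mul_pow_le_exp (hβ : 0 < β) (hβn : 6 ≤ β * n) (hk : k = ⌊β * n⌋₊)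
    (hN : (N : ℝ) ≤ 2 ^ n) {M : ℝ} (hM : 0 ≤ M) :
    3 * (4 ^ n * ((4 * n ^ 2 * N : ℕ) : ℝ) * Real.exp (-(4 * (M + 7) / β)) ^ (k / 2)) ≤
      Real.exp (-M * n) := by
  have hn : n ≠ 0 := by rintro rfl; norm_num at hβn
  have hkβ' : β * n ≤ k + 1 := by rw [hk]; exact (Nat.lt_floor_add_one _).le
  have hhalf : β * n / 4 ≤ ((k / 2 : ℕ) : ℝ) := by
    have h1 : k ≤ 2 * (k / 2) + 1 := by omega
    have h2 : (k : ℝ) ≤ 2 * ((k / 2 : ℕ) : ℝ) + 1 := by exact_mod_cast h1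
    linarith
  have h1 : Real.exp (-(4 * (M + 7) / β)) ^ (k / 2) ≤ Real.exp (-((M + 7) * n)) := by
    rw [← Real.exp_nat_mul]
    refine Real.exp_le_exp.2 ?_
    have h2 : (M + 7) * n = β * n / 4 * (4 * (M + 7) / β) := by field_simp
    have h3 : β * n / 4 * (4 * (M + 7) / β) ≤ ((k / 2 : ℕ) : ℝ) * (4 * (M + 7) / β) := by gcongr
    linarith
  have h2 : (n : ℝ) ≤ 2 ^ n := by exact_mod_cast (Nat.lt_two_pow_self (n := n)).le
  have h3 : (12 : ℝ) ≤ 12 ^ n := le_self_pow₀ (by norm_num) hn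
  have h4 : (384 : ℝ) ≤ Real.exp 7 := by
    have := Real.exp_one_gt_d9
    calc (384 : ℝ) ≤ 2.7 ^ 7 := by norm_num
      _ ≤ Real.exp 1 ^ 7 := by gcongr; linarith
      _ = Real.exp 7 := by rw [← Real.exp_nat_mul]; norm_num
  push_cast
  calc 3 * (4 ^ n * (4 * (n : ℝ) ^ 2 * N) * Real.exp (-(4 * (M + 7) / β)) ^ (k / 2))
      ≤ 3 * (4 ^ n * (4 * (2 ^ n) ^ 2 * 2 ^ n) * Real.exp (-((M + 7) * n))) := by gcongr
    _ = 12 * (4 ^ n * (2 ^ n) ^ 2 * 2 ^ n) * Real.exp (-((M + 7) * n)) := by ring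
    _ ≤ 12 ^ n * (4 ^ n * (2 ^ n) ^ 2 * 2 ^ n) * Real.exp (-((M + 7) * n)) := by gcongr
    _ = 384 ^ n * Real.exp (-((M + 7) * n)) := by
        rw [← pow_mul, mul_comm n 2, pow_mul, ← mul_pow, ← mul_pow, ← mul_pow]; norm_num
    _ ≤ Real.exp 7 ^ n * Real.exp (-((M + 7) * n)) := by gcongr
    _ = Real.exp (-M * n) := by
        rw [← Real.exp_nat_mul, ← Real.exp_add]; congr 1; ring

/-- The decay `(1 - p + ε₀) ^ (n - 4 k)` suffices to get below `1 / (N √n)` when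
`N ≤ (1 - p + 2 ε₀) ^ (-n)` and `k` is a small multiple of `n`. -/
lemma decay_le {ρ ρ' : ℝ} (hρ2 : 1 / 2 ≤ ρ) (hρρ' : ρ < ρ')
    (hβρ : β * (2 * Real.log 16) ≤ Real.log (ρ' / ρ)) (hkβ : (k : ℝ) ≤ β * n) (h4k : 4 * k ≤ n)
    (hN : 0 < N) (hNρ : (N : ℝ) * ρ' ^ n ≤ 1) (hz : 0 < z) (hzn : z ^ 16 = n)
    (hn : 8 ≤ (Real.log (ρ' / ρ)) ^ 2 * n) (hn1 : 1 ≤ (n : ℝ)) {R : ℝ} (hR : 1 ≤ R) :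
    ρ ^ (n - 4 * k) ≤ R / (N * z ^ 8) := by
  have hN' : (0 : ℝ) < N := by exact_mod_cast hN
  have hρ0 : 0 < ρ := by linarith
  have hρ'0 : 0 < ρ' := by linarith
  set g := Real.log (ρ' / ρ) with hg
  have hg0 : 0 < g := Real.log_pos ((one_lt_div hρ0).2 hρρ')
  have hgexp : ρ' = ρ * Real.exp g := by rw [hg, Real.exp_log (by positivity)]; field_simp
  have hz8 : z ^ 8 ≤ Real.exp (g * n / 2) := by
    refine le_trans ?_ (Real.pow_div_factorial_le_exp (g * n / 2) (by positivity) 2)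
    have h1 : z ^ 8 ≤ n := by
      refine abs_le_of_sq_le_sq' ?_ (by positivity) |>.2
      rw [← pow_mul, hzn]
      nlinarith
    norm_num [Nat.factorial]
    nlinarith
  have hpow : (1 : ℝ) ≤ ρ ^ (4 * k) * Real.exp (g * n / 2) := by
    have h1 : (1 / 2 : ℝ) ^ (4 * k) ≤ ρ ^ (4 * k) := by gcongr
    have h2 : (16 : ℝ) ^ k ≤ Real.exp (g * n / 2) := by
      rw [← Real.exp_log (show (0 : ℝ) < 16 by norm_num), ← Real.exp_nat_mul]
      refine Real.exp_le_exp.2 ?_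
      have h3 : 0 < Real.log 16 := Real.log_pos (by norm_num)
      have h4 : (k : ℝ) * Real.log 16 ≤ β * n * Real.log 16 := by gcongr
      nlinarith
    calc (1 : ℝ) = (1 / 2 : ℝ) ^ (4 * k) * 16 ^ k := by
          rw [pow_mul, ← mul_pow]; norm_num
      _ ≤ _ := by gcongr
  have hhalf : Real.exp (g * n) = Real.exp (g * n / 2) * Real.exp (g * n / 2) := by
    rw [← Real.exp_add]; congr 1; ring
  rw [le_div_iff₀ (by positivity)]
  have h5 : ρ ^ (n - 4 * k) * ρ ^ (4 * k) = ρ ^ n := by rw [← pow_add]; congr 1; omega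
  calc ρ ^ (n - 4 * k) * (N * z ^ 8)
      ≤ ρ ^ (n - 4 * k) * (N * Real.exp (g * n / 2)) * 1 := by
        rw [mul_one]; gcongr
    _ ≤ ρ ^ (n - 4 * k) * (N * Real.exp (g * n / 2)) * (ρ ^ (4 * k) * Real.exp (g * n / 2)) := by
        gcongr
    _ = N * (ρ ^ n * Real.exp (g * n)) := by
        rw [← h5, hhalf]; ring
    _ = N * ρ' ^ n := by rw [hgexp, mul_pow, ← Real.exp_nat_mul, mul_comm (n : ℝ)]
    _ ≤ R := by linarith

end Parameters

/-! ### The bound for product sets -/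

section Conclusion

variable {N n k : ℕ} {A : Fin n → Finset ℤ} {p : ℝ}

lemma IsSpread.mono {k' : ℕ} (hA : IsSpread N n k A) (h : k' ≤ k) : IsSpread N n k' A :=
  ⟨hA.neg_mem, hA.isTwoIntervals, hA.le_card, hA.abs_le, fun i hi => hA.le_abs i (hi.trans_le h)⟩

/-- For `N ≤ √n` the Littlewood–Offord bound alone controls the concentration function, for
every vector of the product set. -/
lemma IsSpread.levyConcentration_le_of_le (hA : IsSpread N n k A) (hp0 : 0 < p) (hp : p ≤ 1 / 2)
    (hN : 0 < N) (hn : 0 < n) (hkn : k ≤ n) {x : Fin n → ℤ} (hx : ∀ i, x i ∈ A i) {s : ℕ} {w : ℝ}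
    (hs : 2 * w + 1 ≤ s) {Ω : Type*} [MeasurableSpace Ω] {P : Measure Ω} [IsProbabilityMeasure P]
    {b : Fin n → Ω → ℝ} (hb : IsIIDBernoulli P p b) :
    levyConcentration P (fun ω => ∑ i, b i ω * (x i : ℝ)) w ≤
      (s + N) * ((N : ℝ)⁻¹ * (1 / √(2 * p * (k + 1)))) := by
  have hp1 : p ≤ 1 := by linarith
  refine levyConcentration_le fun u => ?_
  obtain ⟨t, ht⟩ := prob_window_le hp0.le hp1 hb x (4 * n ^ 2 * N) hs u
  exact ht.trans (sum_range_le_of_windowMean_le hN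
    (fun t => walk_nonneg hp0.le hp1 pointMass_nonneg n t)
    (fun t => hA.windowMean_walk_le hp0 hp hN hkn le_rfl hx hkn hn t) s t)

lemma levyConcentration_le_of_windowMean_le (hp0 : 0 ≤ p) (hp1 : p ≤ 1) {x : Fin n → ℤ} {s q : ℕ}
    {w H : ℝ} (hs0 : 0 < s) (hs : 2 * w + 1 ≤ s) {Ω : Type*} [MeasurableSpace Ω] {P : Measure Ω}
    [IsProbabilityMeasure P] {b : Fin n → Ω → ℝ} (hb : IsIIDBernoulli P p b)
    (hH : ∀ t : ZMod q,
      windowMean s (windowMean (2 * s) (walk p (coordMod q x) pointMass n)) t ≤ H) :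
    levyConcentration P (fun ω => ∑ i, b i ω * (x i : ℝ)) w ≤ 2 * s * H := by
  refine levyConcentration_le fun u => ?_
  obtain ⟨t, ht⟩ := prob_window_le hp0 hp1 hb x q hs u
  refine (ht.trans (sum_range_le_windowMean hs0
    (fun t => walk_nonneg hp0 hp1 pointMass_nonneg n t) t)).trans ?_
  gcongr
  exact hH _

/-- All but an exponentially small part of a spread product set consists of vectors whose
concentration function at scale `√n` is at most `L / N`, with `L` independent of the rate of
decay `M`. -/
theorem exists_forall_card_le (δ ε p : ℝ) (hδ : 0 < δ) (hε : 0 < ε) (hp0 : 0 < p)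
    (hp : p ≤ 1 / 2) :
    ∃ L : ℝ, 0 < L ∧ ∀ M : ℝ, 1 ≤ M → ∃ n₀ : ℕ, 1 ≤ n₀ ∧
      ∀ n N : ℕ, n₀ ≤ n → 1 ≤ N → (N : ℝ) ≤ (1 - p + ε) ^ (-(n : ℤ)) →
        ∀ A : Fin n → Finset ℤ, IsSpread N n ⌊δ * n⌋₊ A →
          ∀ (Ω : Type*) [MeasurableSpace Ω] (P : Measure Ω) [IsProbabilityMeasure P]
            (b : Fin n → Ω → ℝ), IsIIDBernoulli P p b →
            (((Fintype.piFinset A).filter fun x : Fin n → ℤ =>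
                L * (N : ℝ)⁻¹ ≤
                  levyConcentration P (fun ω => ∑ i, b i ω * (x i : ℝ)) √(n : ℝ)).card : ℝ)
              ≤ Real.exp (-M * n) * ((Fintype.piFinset A).card : ℝ) := by
  -- `ρ` is the decay factor of a good step, `ρ'` the allowed growth rate of `1 / N`.
  set ε₀ := min (ε / 2) (p / 4) with hε₀
  have hε₀0 : 0 < ε₀ := by positivity
  have hε₀p : ε₀ ≤ p / 4 := min_le_right _ _
  have hε₀ε : ε₀ ≤ ε / 2 := min_le_left _ _
  set ρ := 1 - p + ε₀ with hρ
  set ρ' := 1 - p + 2 * ε₀ with hρ'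
  have hρ2 : 1 / 2 ≤ ρ := by rw [hρ]; linarith
  have hρρ' : ρ < ρ' := by rw [hρ, hρ']; linarith
  have hρ'1 : ρ' ≤ 1 := by rw [hρ']; linarith
  set g := Real.log (ρ' / ρ) with hg
  have hg0 : 0 < g := Real.log_pos ((one_lt_div (by linarith)).2 hρρ')
  have hlog : 0 < Real.log 16 := Real.log_pos (by norm_num)
  set β := min (min δ (1 / 4)) (g / (2 * Real.log 16)) with hβ
  have hβ0 : 0 < β := by positivity
  have hβδ : β ≤ δ := (min_le_left _ _).trans (min_le_left _ _)
  have hβ4 : β ≤ 1 / 4 := (min_le_left _ _).trans (min_le_right _ _)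
  have hβg : β * (2 * Real.log 16) ≤ g := by
    rw [← le_div_iff₀ (by positivity)]; exact min_le_right _ _
  set C := 1 / √(2 * p * β) with hC
  have hC0 : 0 < C := by have : 0 < √(2 * p * β) := Real.sqrt_pos.2 (by positivity); positivity
  refine ⟨32 * C / p + 1, by positivity, fun M hM => ?_⟩
  -- `M` enters through `τ` and `R`, but not through the constant chosen above
  set τ := Real.exp (-(4 * (M + 7) / β)) with hτ
  have hτ0 : 0 < τ := Real.exp_pos _
  have hτ1 : τ ≤ 1 := Real.exp_le_one_iff.2 (by
    have : 0 ≤ 4 * (M + 7) / β := by have : 0 ≤ M + 7 := by linarith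
                                     positivity
    linarith)
  set R := max 1 (3 * C / (ε₀ * τ)) with hR
  have hR1 : 1 ≤ R := le_max_left _ _
  have hR0 : 0 < R := by linarith
  have hpβ : 0 < p * β := by positivity
  -- all conditions on `n` are lower bounds, for `n` or for `z = n ^ (1 / 16)`
  set Z := max (max 2 (12 / τ)) (max (6 / (p * β) ^ 4) (32 * R / τ)) with hZ
  have hZ1 : 2 ≤ Z := (le_max_left _ _).trans (le_max_left _ _)
  have hZ2 : 12 / τ ≤ Z := (le_max_right _ _).trans (le_max_left _ _)
  have hZ3 : 6 / (p * β) ^ 4 ≤ Z := (le_max_left _ _).trans (le_max_right _ _)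
  have hZ4 : 32 * R / τ ≤ Z := (le_max_right _ _).trans (le_max_right _ _)
  set Y := max (max (Z ^ 16) (6 / β)) (max (8 / g ^ 2) (8 * R / (p * β))) with hY
  have hY1 : Z ^ 16 ≤ Y := (le_max_left _ _).trans (le_max_left _ _)
  have hY2 : 6 / β ≤ Y := (le_max_right _ _).trans (le_max_left _ _)
  have hY3 : 8 / g ^ 2 ≤ Y := (le_max_left _ _).trans (le_max_right _ _)
  have hY4 : 8 * R / (p * β) ≤ Y := (le_max_right _ _).trans (le_max_right _ _)
  refine ⟨max 1 ⌈Y⌉₊, le_max_left _ _, fun n N hn hN1 hNε A hA' Ω _ P _ b hb => ?_⟩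
  have hn1 : 1 ≤ n := (le_max_left _ _).trans hn
  have hn1' : (1 : ℝ) ≤ n := by exact_mod_cast hn1
  have hYn : Y ≤ n := Nat.ceil_le.1 ((le_max_right _ _).trans hn)
  set k := ⌊β * n⌋₊ with hk
  have hA : IsSpread N n k A := hA'.mono (Nat.floor_mono (by gcongr))
  have hβn : 6 ≤ β * n := by
    rw [← div_le_iff₀' hβ0]; exact hY2.trans hYn
  have hkβ : (k : ℝ) ≤ β * n := Nat.floor_le (by positivity)
  have h4k : 4 * k ≤ n := by
    have : (4 * k : ℝ) ≤ n := by
      have := mul_le_mul_of_nonneg_right hβ4 (zero_le_one.trans hn1')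
      linarith
    exact_mod_cast this
  have hkn : k + 1 ≤ n := by
    have : 6 ≤ (n : ℝ) := by
      have := mul_le_mul_of_nonneg_right hβ4 (zero_le_one.trans hn1')
      linarith
    have : 6 ≤ n := by exact_mod_cast this
    omega
  obtain ⟨z, hz0, hzn⟩ : ∃ z : ℝ, 0 < z ∧ z ^ 16 = n :=
    ⟨(n : ℝ) ^ ((1 : ℝ) / 16), by positivity, by
      rw [← Real.rpow_natCast, ← Real.rpow_mul (by positivity)]; norm_num⟩
  have hz8 : √(n : ℝ) = z ^ 8 := by
    rw [← hzn, show z ^ 16 = (z ^ 8) ^ 2 by ring, Real.sqrt_sq (by positivity)]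
  have hZz : Z ≤ z := by
    refine le_of_pow_le_pow_left₀ (n := 16) (by norm_num) hz0.le ?_
    rw [hzn]; exact hY1.trans hYn
  have hz2 : 2 ≤ z := hZ1.trans hZz
  have hz1 : 1 ≤ z := by linarith
  have hz81 : 1 ≤ z ^ 8 := one_le_pow₀ hz1
  have hN' : (0 : ℝ) < N := by exact_mod_cast hN1
  obtain ⟨hc1, hc2⟩ := littlewoodOfford_const_bounds hp0 hp hβ0 hN1 hz0 hzn hk hkn
  set c := (N : ℝ)⁻¹ * (1 / √(2 * p * (k + 1))) with hc
  set s := ⌈2 * z ^ 8 + 1⌉₊ with hs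
  have hs1 : 2 * z ^ 8 + 1 ≤ s := Nat.le_ceil _
  have hs2 : (s : ℝ) ≤ 4 * z ^ 8 := by
    have := (Nat.ceil_lt_add_one (show 0 ≤ 2 * z ^ 8 + 1 by positivity)).le
    linarith
  have hs0 : 0 < s := Nat.ceil_pos.2 (by positivity)
  have hfinal : 2 * s * (4 * c / p) < (32 * C / p + 1) * (N : ℝ)⁻¹ := by
    calc 2 * s * (4 * c / p) ≤ 2 * (4 * z ^ 8) * (4 * (C * (1 / (N * z ^ 8))) / p) := by gcongr
      _ = 32 * C / p * (N : ℝ)⁻¹ := by field_simp; norm_num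
      _ < _ := by rw [add_mul, one_mul]; linarith [inv_pos.2 hN']
  rw [hz8]
  rcases lt_or_ge (N : ℝ) (z ^ 8) with hNz | hNz
  · -- no vector at all has a large concentration function
    rw [card_eq_zero.2, Nat.cast_zero]
    · positivity
    rw [filter_eq_empty_iff]
    intro x hx
    rw [not_le]
    have h1 := hA.levyConcentration_le_of_le hp0 hp hN1 hn1 (by omega)
      (Fintype.mem_piFinset.1 hx) hs1 hb
    refine lt_of_le_of_lt (h1.trans ?_) hfinal
    have hc0 : 0 < c := lt_of_lt_of_le (by positivity) hc1
    have h2 : (s : ℝ) + N ≤ 2 * s := by linarith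
    have h3 : c ≤ 4 * c / p := by
      rw [le_div_iff₀ hp0]
      have := mul_le_mul_of_nonneg_left (show p ≤ 4 by linarith) hc0.le
      linarith
    exact mul_le_mul h2 h3 hc0.le (by positivity)
  have hρ'0 : 0 < ρ' := by linarith
  have hNρ : (N : ℝ) * ρ' ^ n ≤ 1 := by
    have h1 : ρ' ≤ 1 - p + ε := by rw [hρ']; linarith
    rw [zpow_neg, zpow_natCast] at hNε
    have h2 : 0 < (1 - p + ε) ^ n := pow_pos (by linarith) n
    calc (N : ℝ) * ρ' ^ n ≤ ((1 - p + ε) ^ n)⁻¹ * (1 - p + ε) ^ n := by gcongr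
      _ = 1 := inv_mul_cancel₀ h2.ne'
  have hN2 : (N : ℝ) ≤ 2 ^ n := by
    have h1 : (1 / 2 : ℝ) ^ n ≤ ρ' ^ n := by gcongr; linarith
    have h2 : (N : ℝ) * (1 / 2) ^ n ≤ 1 := le_trans (by gcongr) hNρ
    rwa [one_div, inv_pow, ← div_eq_mul_inv, div_le_one (by positivity)] at h2
  have hq0 : 0 < 4 * n ^ 2 * N := by positivity
  have : NeZero (4 * n ^ 2 * N) := ⟨hq0.ne'⟩
  have hdecay := decay_le (k := k) hρ2 hρρ' hβg hkβ h4k hN1 hNρ hz0 hzn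
    (by rw [← div_le_iff₀' (by positivity)]; exact hY3.trans hYn) hn1' hR1
  have hRn : R * Real.exp (-(p * β / 8 * n)) ≤ 1 := by
    rw [Real.exp_neg, ← div_eq_mul_inv, div_le_one (Real.exp_pos _)]
    have h1 := Real.add_one_le_exp (p * β / 8 * n)
    have h2 := hY4.trans hYn
    rw [div_le_iff₀ hpβ] at h2
    linarith
  have hmain := hA.card_exists_lt_le_of_pow (q := 4 * n ^ 2 * N) (s := s) (ε := ε₀) (τ := τ) (R := R)
    hp0 hp hβ0 hβ4 hzn hz2 hNz hk hβn le_rfl (by linarith) hc hε₀0 (by linarith) hτ0 hτ1 hdecay hR1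
    (le_max_right _ _) (by rw [← div_le_iff₀' hτ0]; exact hZ2.trans hZz)
    (by
      rw [← div_le_iff₀' (by positivity)]
      exact (hZ3.trans hZz).trans (le_self_pow₀ hz1 (by norm_num)))
    (by
      rw [← div_le_iff₀' hτ0]
      exact (hZ4.trans hZz).trans (le_self_pow₀ hz1 (by norm_num))) hRn
  have hexp := three_mul_pow_le_exp hβ0 hβn hk hN2 (M := M) (by linarith)
  refine le_trans ?_ (hmain.trans (mul_le_mul_of_nonneg_right hexp (by positivity)))
  refine Nat.cast_le.2 (card_le_card fun x hx => ?_)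
  rw [mem_filter] at hx ⊢
  refine ⟨hx.1, ?_⟩
  by_contra! h
  have := levyConcentration_le_of_windowMean_le hp0.le (by linarith) hs0 hs1 hb h
  linarith [hx.2]

end Conclusion

/-! ### Admissible sets and the standard box -/

section Admissible

lemma isSpread_of_admissibleFactors {N n : ℕ} {K δ : ℝ} {A : Fin n → Finset ℤ} (hδ : 0 ≤ δ)
    (hA : AdmissibleFactors N n K δ A) : IsSpread N n ⌊δ * n⌋₊ A where
  neg_mem := hA.symmetric
  isTwoIntervals i := by
    by_cases h : ((i : ℕ) + 1 : ℝ) ≤ δ * n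
    · obtain ⟨⟨I, J, hI, hJ, h⟩, -⟩ := hA.two_intervals i h
      exact ⟨I, J, hI, hJ, h⟩
    · exact ⟨A i, A i, (hA.interval i (not_le.1 h)).1, (hA.interval i (not_le.1 h)).1,
        (union_self _).symm⟩
  le_card i := by
    by_cases h : ((i : ℕ) + 1 : ℝ) ≤ δ * n
    · exact (hA.two_intervals i h).2.1
    · have := (hA.interval i (not_le.1 h)).2
      omega
  abs_le i a ha := by
    have h1 := hA.lt_mul i a ha
    have h2 := hA.lt_mul i (-a) (hA.symmetric i a ha)
    exact abs_le.2 ⟨by linarith, h1.le⟩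
  le_abs i hi a ha := by
    have h : ((i : ℕ) + 1 : ℝ) ≤ δ * n := by
      have := (Nat.le_floor_iff (by positivity : 0 ≤ δ * n)).1 (Nat.succ_le_of_lt hi)
      exact_mod_cast this
    have h1 := Finset.disjoint_left.1 (hA.two_intervals i h).2.2 ha
    rw [mem_Icc, not_and_or] at h1
    rw [le_abs]
    omega

lemma isAdmissible_standardBox {N n : ℕ} {δ : ℝ} (hδ : 0 ≤ δ) (hN : 1 ≤ N) (hn : 3 ≤ n) :
    IsAdmissible N n 3 δ (standardBox N n δ) := by
  have hδn : 0 ≤ δ * n := by positivity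
  have hlt (i : Fin n) : (i : ℕ) < ⌊δ * n⌋₊ ↔ ((i : ℕ) + 1 : ℝ) ≤ δ * n := by
    rw [← Nat.succ_le_iff, Nat.le_floor_iff hδn]
    push_cast
    rfl
  have hdisj : Disjoint (Icc (-2 * (N : ℤ)) (-(N : ℤ) - 1)) (Icc ((N : ℤ) + 1) (2 * N)) := by
    rw [Finset.disjoint_left]
    intro a ha ha'
    rw [mem_Icc] at ha ha'
    omega
  have hcard : #(Icc (-2 * (N : ℤ)) (-(N : ℤ) - 1) ∪ Icc ((N : ℤ) + 1) (2 * N)) = 2 * N := by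
    rw [card_union_of_disjoint hdisj, Int.card_Icc, Int.card_Icc]
    omega
  have hcard' : #(Icc (-(N : ℤ)) N) = 2 * N + 1 := by
    rw [Int.card_Icc]; omega
  refine ⟨_, rfl, ?_, ?_, ?_, ?_, ?_⟩
  · intro i a ha
    split_ifs at ha ⊢
    · simp only [mem_union, mem_Icc] at ha ⊢; omega
    · simp only [mem_Icc] at ha ⊢; omega
  · intro i hi
    rw [if_neg (by rw [hlt]; exact not_le.2 hi)]
    exact ⟨⟨_, _, rfl⟩, hcard'.ge⟩
  · intro i hi
    rw [if_pos ((hlt i).2 hi)]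
    refine ⟨⟨_, _, ⟨_, _, rfl⟩, ⟨_, _, rfl⟩, rfl⟩, hcard.ge, ?_⟩
    rw [Finset.disjoint_left]
    intro a ha ha'
    simp only [mem_union, mem_Icc] at ha ha'
    omega
  · have h : ∀ i ∈ (univ : Finset (Fin n)), (#(if (i : ℕ) < ⌊δ * n⌋₊ then
        Icc (-2 * (N : ℤ)) (-(N : ℤ) - 1) ∪ Icc ((N : ℤ) + 1) (2 * N)
        else Icc (-(N : ℤ)) N) : ℝ) ≤ 3 * N := by
      intro i _
      split_ifs
      · rw [hcard]; push_cast; linarith [(Nat.cast_nonneg N : (0 : ℝ) ≤ N)]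
      · rw [hcard']; push_cast
        have : (1 : ℝ) ≤ N := by exact_mod_cast hN
        linarith
    exact (prod_le_prod (fun _ _ => Nat.cast_nonneg _) h).trans_eq (by simp)
  · intro i a ha
    have h1 : 3 * (N : ℤ) ≤ n * N := by gcongr; exact_mod_cast hn
    have h2 : a ≤ 2 * N := by
      split_ifs at ha
      · simp only [mem_union, mem_Icc] at ha; omega
      · simp only [mem_Icc] at ha; omega
    have : (1 : ℤ) ≤ N := by exact_mod_cast hN
    omega

/-- The probability of an event under the uniform distribution is a quotient of cardinalities. -/
lemma measureReal_preimage_of_hasLaw_uniformOn {n : ℕ} {B : Finset (Fin n → ℤ)}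
    {Ω : Type*} [MeasurableSpace Ω] {P : Measure Ω} {ξ : Ω → Fin n → ℤ}
    (hξ : HasLaw ξ (uniformOn (B : Set (Fin n → ℤ))) P) (Q : (Fin n → ℤ) → Prop)
    [DecidablePred Q] :
    P.real {ω | Q (ξ ω)} = #{x ∈ B | Q x} / #B := by
  have hmeas : MeasurableSet {x | Q x} := DiscreteMeasurableSpace.forall_measurableSet _
  have h1 : P {ω | Q (ξ ω)} = uniformOn (B : Set (Fin n → ℤ)) {x | Q x} := by
    rw [← hξ.map_eq, Measure.map_apply_of_aemeasurable hξ.aemeasurable hmeas]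
    rfl
  have h2 : (B : Set (Fin n → ℤ)) ∩ {x | Q x} = (({x ∈ B | Q x} : Finset _) : Set (Fin n → ℤ)) := by
    ext x; simp
  rw [measureReal_def, h1, uniformOn, cond_apply B.measurableSet, h2, Measure.count_apply_finset,
    Measure.count_apply_finset, ENNReal.toReal_mul, ENNReal.toReal_inv]
  simp [div_eq_inv_mul]

end Admissible

end BernoulliWalk

theorem mainTheorem3 :
    (∀ δ ε p K : ℝ, 0 < δ → δ ≤ 1 → 0 < ε → ε ≤ 1 → 0 < p → p ≤ 1 / 2 → 1 ≤ K →
      ∃ L : ℝ, 0 < L ∧ ∀ M : ℝ, 1 ≤ M → ∃ n₀ : ℕ, 1 ≤ n₀ ∧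
        ∀ n N : ℕ, n₀ ≤ n → 1 ≤ N → (N : ℝ) ≤ (1 - p + ε) ^ (-(n : ℤ)) →
          ∀ 𝒜 : Finset (Fin n → ℤ), IsAdmissible N n K δ 𝒜 →
            ∀ (Ω : Type*) [MeasurableSpace Ω] (P : Measure Ω) [IsProbabilityMeasure P]
              (b : Fin n → Ω → ℝ), IsIIDBernoulli P p b →
              ((𝒜.filter fun x : Fin n → ℤ =>
                  L * (N : ℝ)⁻¹ ≤
                    levyConcentration P (fun ω => ∑ i, b i ω * (x i : ℝ)) √(n : ℝ)).card : ℝ)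
                ≤ Real.exp (-M * n) * (𝒜.card : ℝ)) ∧
    (∀ δ ε p : ℝ, 0 < δ → δ ≤ 1 → 0 < p → p ≤ 1 / 2 → 0 < ε → ε < p →
      ∃ L : ℝ, 0 < L ∧ ∀ M : ℝ, 1 ≤ M → ∃ n₀ : ℕ, 1 ≤ n₀ ∧
        ∀ n N : ℕ, n₀ ≤ n → 1 ≤ N → (N : ℝ) ≤ (1 - p + ε) ^ (-(n : ℤ)) →
          ∀ (Ω : Type*) [MeasurableSpace Ω] (P : Measure Ω) [IsProbabilityMeasure P]
            (b : Fin n → Ω → ℝ), IsIIDBernoulli P p b →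
            ∀ (Ω' : Type*) [MeasurableSpace Ω'] (P' : Measure Ω') [IsProbabilityMeasure P']
              (ξ : Ω' → Fin n → ℤ),
              HasLaw ξ (uniformOn (standardBox N n δ : Set (Fin n → ℤ))) P' →
              P'.real {ω' | L * (N : ℝ)⁻¹ <
                  levyConcentration P (fun ω => ∑ i, b i ω * (ξ ω' i : ℝ)) √(n : ℝ)}
                ≤ Real.exp (-M * n)) := by
  refine ⟨fun δ ε p K hδ _ hε _ hp0 hp _ => ?_, fun δ ε p hδ _ hp0 hp hε _ => ?_⟩
  · obtain ⟨L, hL, h⟩ := BernoulliWalk.exists_forall_card_le δ ε p hδ hε hp0 hp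
    refine ⟨L, hL, fun M hM => ?_⟩
    obtain ⟨n₀, hn₀, h⟩ := h M hM
    refine ⟨n₀, hn₀, fun n N hn hN hNε 𝒜 h𝒜 Ω _ P _ b hb => ?_⟩
    obtain ⟨A, rfl, hA⟩ := h𝒜
    exact h n N hn hN hNε A (BernoulliWalk.isSpread_of_admissibleFactors hδ.le hA) Ω P b hb
  · obtain ⟨L, hL, h⟩ := BernoulliWalk.exists_forall_card_le δ ε p hδ hε hp0 hp
    refine ⟨L, hL, fun M hM => ?_⟩
    obtain ⟨n₀, hn₀, h⟩ := h M hM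
    refine ⟨max n₀ 3, hn₀.trans (le_max_left _ _),
      fun n N hn hN hNε Ω _ P _ b hb Ω' _ P' _ ξ hξ => ?_⟩
    obtain ⟨A, hbox, hA⟩ := BernoulliWalk.isAdmissible_standardBox hδ.le hN
      ((le_max_right _ _).trans hn)
    have hspread := BernoulliWalk.isSpread_of_admissibleFactors hδ.le hA
    have hcard := h n N ((le_max_left _ _).trans hn) hN hNε A
      hspread Ω P b hb
    rw [← hbox] at hcard
    have hne : (standardBox N n δ).Nonempty := by
      rw [hbox, Fintype.piFinset_nonempty]
      intro i
      have := hspread.le_card i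
      exact Finset.card_pos.1 (by omega)
    have hpos : (0 : ℝ) < (standardBox N n δ).card := by exact_mod_cast hne.card_pos
    have hmono : P'.real {ω' | L * (N : ℝ)⁻¹ <
        levyConcentration P (fun ω => ∑ i, b i ω * (ξ ω' i : ℝ)) √(n : ℝ)} ≤
        P'.real {ω' | L * (N : ℝ)⁻¹ ≤
        levyConcentration P (fun ω => ∑ i, b i ω * (ξ ω' i : ℝ)) √(n : ℝ)} :=
      measureReal_mono (Set.ofPred_subset_ofPred.2 fun ω' h' => h'.le)
    refine hmono.trans ?_
    rw [BernoulliWalk.measureReal_preimage_of_hasLaw_uniformOn hξ fun x : Fin n → ℤ =>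
      L * (N : ℝ)⁻¹ ≤ levyConcentration P (fun ω => ∑ i, b i ω * (x i : ℝ)) √(n : ℝ),
      div_le_iff₀ hpos]
    exact hcard
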